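/- Let $n\in\mathbb{N}$ and $0<T<\infty$. Equip $\mathbb{R}^n$ with $\|x\|_n=\sum_i|x_i|$ and real $n\times n$ matrices with $\|A\|_{n\times n}=\max_i\sum_j|a_{ij}|$. Let $G[0,T]$ be the Banach space of regulated functions $x:[0,T]\to\mathbb{R}^n$ (functions having finite one-sided limits) with the norm $\|x\|_\infty=\sup_t\|x(t)\|_n$, and let $B(x_0,\rho)$ be the closed ball in $G[0,T]$. Write $\int_a^b DU(\tau,t)$ for the Kurzweil integral, i.e. the element $I$ such that for every $\varepsilon>0$ there is a gauge $\delta:[a,b]\to(0,\infty)$ with $\|\sum_j[U(\tau_j,t_j)-U(\tau_j,t_{j-1})]-I\|<\varepsilon$ for all tagged partitions $a=t_0\le\dots\le t_\nu=b$, $\tau_j\in[t_{j-1},t_j]$, satisfying $[t_{j-1},t_j]\subset(\tau_j-\delta(\tau_j),\tau_j+\delta(\tau_j))$ for all $j$. For $h:[0,T]\to\mathbb{R}$ nondecreasing and $\omega:[0,\infty)\to[0,\infty)$ increasing and continuous with $\omega(0)=0$, let $\mathcal{F}(\Omega\times[0,T],h,\omega;X)$ be the set of functions $f:\Omega\times[0,T]\to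 X$ with $$\|f(x,t_2)-f(x,t_1)\|\le|h(t_2)-h(t_1)|,\qquad \|f(x,t_2)-f(x,t_1)-f(y,t_2)+f(y,t_1)\|\le\omega(\|x-y\|_n)\,|h(t_2)-h(t_1)|$$ for all $x,y\in\Omega$, $t_1,t_2\in[0,T]$. Let $\Omega\subset\mathbb{R}^n$ and $\Lambda\subset\mathbb{R}$ be open, $F:\Lambda\times\Omega\times[0,T]\to\mathbb{R}^n$, $x_0\in G[0,T]$ and $\rho>0$, and assume: (B1) there are $h$, $\omega$ as above such that $F(\lambda,\cdot,\cdot)\in\mathcal{F}(\Omega\times[0,T],h,\omega;\mathbb{R}^n)$ for every $\lambda\in\Lambda$; (B2) for every $\lambda\in\Lambda$, $x_0(s)\in\Omega$ and $x_0(s)=x_0(0)+\int_0^s DF(\lambda,x_0(\tau),t)$ for all $s\in[0,T]$, and $x_0(0)=x_0(T)$; moreover $x(t)\in\Omega$ for all $t\in[0,T]$ and $x\in B(x_0,\rho)$; (B3) there is a nondecreasing $\gamma:[0,T]\to\mathbb{R}$ such that for every $\varepsilon>0$ there is $\delta>0$ with $$\|F(\lambda_1,x,t)-F(\lambda_2,x,t)-F(\lambda_1,x,s)+F(\lambda_2,x,s)\|_n\le\varepsilon\,|\gamma(t)-\gamma(s)|$$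 for all $x\in\Omega$, $t,s\in[0,T]$ and $\lambda_1,\lambda_2\in\Lambda$ with $|\lambda_1-\lambda_2|<\delta$; (C1) the derivative (Jacobian matrix) $F'_x(\lambda,x,t)$ exists for all $(\lambda,x,t)\in\Lambda\times\Omega\times[0,T]$, is continuous in $x\in\Omega$ for each $(\lambda,t)$, and there are $\widetilde h:[0,T]\to[0,\infty)$ nondecreasing and $\widetilde\omega:[0,\infty)\to[0,\infty)$ increasing and continuous with $\widetilde\omega(0)=0$ such that $F'_x(\lambda,\cdot,\cdot)\in\mathcal{F}(\Omega\times[0,T],\widetilde h,\widetilde\omega;\mathbb{R}^{n\times n})$ for every $\lambda\in\Lambda$; (C3) there is a nondecreasing $\widetilde\gamma:[0,T]\to\mathbb{R}$ such that for every $\varepsilon>0$ there is $\delta>0$ with $$\|F'_x(\lambda_1,x,t)-F'_x(\lambda_2,x,t)-F'_x(\lambda_1,x,s)+F'_x(\lambda_2,x,s)\|_{n\times n}\le\varepsilon\,|\widetilde\gamma(t)-\widetilde\gamma(s)|$$ for all $x\in\Omega$, $t,s\in[0,T]$ and $\lambda_1,\lambda_2\in\Lambda$ with $|\lambda_1-\lambda_2|<\delta$.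 For $\lambda\in\Lambda$ and $x\in B(x_0,\rho)$ define $\Phi(\lambda,x)\in G[0,T]$ by $\Phi(\lambda,x)(s)=x(T)+\int_0^s DF(\lambda,x(\tau),t)$, $s\in[0,T]$. A pair $(y,\mu)\in B(x_0,\rho)\times\Lambda$ with $y=\Phi(\mu,y)$ is called a bifurcation point of the equation $x=\Phi(\lambda,x)$ if every neighborhood of $(y,\mu)$ in $B(x_0,\rho)\times\Lambda$ contains a pair $(x,\lambda)$ with $x=\Phi(\lambda,x)$ and $x\ne y$. Let $\lambda_0\in\Lambda$ and suppose that $\mathrm{Id}-\Phi'_x(\lambda_0,x_0)$ is an isomorphism of $G[0,T]$ onto $G[0,T]$, where $\Phi'_x(\lambda_0,x_0)$ is the Fréchet derivative of $\Phi(\lambda_0,\cdot)$ at $x_0$. Then there is $\delta>0$ such that no $(x,\lambda)\in G[0,T]\times\mathbb{R}$ with $\|x-x_0\|_\infty+|\lambda-\lambda_0|<\delta$ is a bifurcation point of the equation $x=\Phi(\lambda,x)$. -/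

import Mathlib

open Set Filter Topology

attribute [local instance] Matrix.linftyOpNormedAddCommGroup

noncomputable section

namespace GenODE

/-! ### The Kurzweil integral -/

/-- `t 0 ≤ τ 0 ≤ t 1 ≤ τ 1 ≤ ⋯ ≤ t ν` is a tagged partition of `[a, b]` with `ν` subintervals
`[t j, t (j + 1)]` and tags `τ j` (`j < ν`); the values of the sequences beyond that are ignored. -/
def IsTaggedPartition (a b : ℝ) (ν : ℕ) (t τ : ℕ → ℝ) : Prop :=
  t 0 = a ∧ t ν = b ∧ ∀ j < ν, t j ≤ t (j + 1) ∧ τ j ∈ Icc (t j) (t (j + 1))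

/-- `δ`-fineness of a tagged partition. -/
def IsFine (δ : ℝ → ℝ) (ν : ℕ) (t τ : ℕ → ℝ) : Prop :=
  ∀ j < ν, Icc (t j) (t (j + 1)) ⊆ Ioo (τ j - δ (τ j)) (τ j + δ (τ j))

/-- `I` is the Kurzweil integral `∫_a^b DU(τ, t)`, for `a ≤ b`. -/
def HasKurzweilIntegral {X : Type*} [NormedAddCommGroup X]
    (U : ℝ → ℝ → X) (a b : ℝ) (I : X) : Prop :=
  ∀ ε > 0, ∃ δ : ℝ → ℝ, (∀ s ∈ Icc a b, 0 < δ s) ∧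
    ∀ (ν : ℕ) (t τ : ℕ → ℝ), IsTaggedPartition a b ν t τ → IsFine δ ν t τ →
      ‖(∑ j ∈ Finset.range ν, (U (τ j) (t (j + 1)) - U (τ j) (t j))) - I‖ < ε

open Classical in
/-- The value of the Kurzweil integral `∫_a^b DU(τ, t)`, for `a ≤ b`
(and `0` if it does not exist). -/
def kurzweilIntegral {X : Type*} [NormedAddCommGroup X] (U : ℝ → ℝ → X) (a b : ℝ) : X :=
  if h : ∃ I, HasKurzweilIntegral U a b I then h.choose else 0

/-! ### Regulated functions -/

/-- `f` is regulated on `[a, b]`. -/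
def IsRegulated {X : Type*} [NormedAddCommGroup X] (f : ℝ → X) (a b : ℝ) : Prop :=
  (∀ t ∈ Ioc a b, ∃ l, Tendsto f (𝓝[<] t) (𝓝 l)) ∧
    ∀ s ∈ Ico a b, ∃ l, Tendsto f (𝓝[>] s) (𝓝 l)

theorem IsRegulated.congr {X : Type*} [NormedAddCommGroup X] {f g : ℝ → X} {a b : ℝ}
    (hf : IsRegulated f a b) (h : ∀ t ∈ Icc a b, f t = g t) : IsRegulated g a b := by
  refine ⟨fun t ht => ?_, fun t ht => ?_⟩
  · obtain ⟨l, hl⟩ := hf.1 t ht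
    refine ⟨l, hl.congr' ?_⟩
    filter_upwards [Ioo_mem_nhdsLT ht.1] with u hu
    exact h u ⟨hu.1.le, hu.2.le.trans ht.2⟩
  · obtain ⟨l, hl⟩ := hf.2 t ht
    refine ⟨l, hl.congr' ?_⟩
    filter_upwards [Ioo_mem_nhdsGT ht.2] with u hu
    exact h u ⟨ht.1.trans hu.1.le, hu.2.le⟩

/-- A regulated function on a compact interval is bounded. -/
theorem IsRegulated.bounded {X : Type*} [NormedAddCommGroup X] {f : ℝ → X} {a b : ℝ}
    (hf : IsRegulated f a b) : ∃ C, ∀ t ∈ Icc a b, ‖f t‖ ≤ C := by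
  refine isCompact_Icc.induction_on (p := fun S => ∃ C, ∀ t ∈ S, ‖f t‖ ≤ C)
    ⟨0, by simp⟩ (fun s t hst ⟨C, hC⟩ => ⟨C, fun u hu => hC u (hst hu)⟩) ?_ ?_
  · rintro s t ⟨C, hC⟩ ⟨D, hD⟩
    refine ⟨max C D, ?_⟩
    rintro u (hu | hu)
    · exact (hC u hu).trans (le_max_left _ _)
    · exact (hD u hu).trans (le_max_right _ _)
  · intro t ht
    have key : ∀ l : Filter ℝ, (∃ y, Tendsto f l (𝓝 y)) → ∃ C, ∀ᶠ u in l, ‖f u‖ ≤ C := by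
      rintro l ⟨y, hy⟩
      exact ⟨‖y‖ + 1, hy.norm.eventually (eventually_le_nhds (by linarith))⟩
    have hL : ∃ C, ∀ᶠ u in 𝓝[<] t, u ∈ Icc a b → ‖f u‖ ≤ C := by
      rcases ht.1.eq_or_lt with h | h
      · refine ⟨0, ?_⟩
        filter_upwards [self_mem_nhdsWithin] with u hu hu'
        exact absurd hu'.1 (by rw [h]; exact not_le.2 hu)
      · obtain ⟨C, hC⟩ := key _ (hf.1 t ⟨h, ht.2⟩)
        exact ⟨C, hC.mono fun u hu _ => hu⟩
    have hR : ∃ C, ∀ᶠ u in 𝓝[>] t, u ∈ Icc a b → ‖f u‖ ≤ C := by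
      rcases ht.2.eq_or_lt with h | h
      · refine ⟨0, ?_⟩
        filter_upwards [self_mem_nhdsWithin] with u hu hu'
        exact absurd hu'.2 (by rw [← h]; exact not_le.2 hu)
      · obtain ⟨C, hC⟩ := key _ (hf.2 t ⟨ht.1, h⟩)
        exact ⟨C, hC.mono fun u hu _ => hu⟩
    obtain ⟨C, hC⟩ := hL
    obtain ⟨D, hD⟩ := hR
    refine ⟨_, inter_mem_nhdsWithin (Icc a b)
      (t := {u | u ∈ Icc a b → ‖f u‖ ≤ max (max C D) ‖f t‖}) ?_, max (max C D) ‖f t‖,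
      fun u hu => hu.2 hu.1⟩
    rw [← nhdsNE_sup_pure, ← nhdsLT_sup_nhdsGT]
    refine ⟨⟨?_, ?_⟩, ?_⟩
    · filter_upwards [hC] with u hu hu'
      exact (hu hu').trans ((le_max_left _ _).trans (le_max_left _ _))
    · filter_upwards [hD] with u hu hu'
      exact (hu hu').trans ((le_max_right _ _).trans (le_max_left _ _))
    · exact fun _ => le_max_right _ _

/-- `ℝⁿ` with the norm `∑ |xᵢ|`. -/
abbrev E (n : ℕ) : Type := PiLp 1 (fun _ : Fin n => ℝ)

/-- Bounded functions `[0, T] → ℝⁿ` with the supremum norm. -/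
abbrev Bdd (n : ℕ) (T : ℝ) : Type :=
  lp (fun _ : Icc (0 : ℝ) T => E n) ⊤

open Classical in
/-- Extension by `0` of a function on `[0, T]`, so that it can be evaluated at real numbers. -/
def ext0 {X : Type*} [Zero X] {T : ℝ} (f : Icc (0 : ℝ) T → X) (t : ℝ) : X :=
  if h : t ∈ Icc (0 : ℝ) T then f ⟨t, h⟩ else 0

/-- The space `G[0, T]` of regulated functions `[0, T] → ℝⁿ` with the supremum norm
(every regulated function is bounded, by `IsRegulated.bounded`). -/
def regulatedSubmodule (n : ℕ) (T : ℝ) : Submodule ℝ (Bdd n T) where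
  carrier := {f | IsRegulated (ext0 (f : Icc (0 : ℝ) T → E n)) 0 T}
  zero_mem' := by
    have h : ext0 ((0 : Bdd n T) : Icc (0 : ℝ) T → E n) = fun _ => 0 := by
      funext t
      simp [ext0]
    rw [mem_ofPred_eq, h]
    exact ⟨fun _ _ => ⟨0, tendsto_const_nhds⟩, fun _ _ => ⟨0, tendsto_const_nhds⟩⟩
  add_mem' := by
    intro f g hf hg
    have h : ext0 ((f + g : Bdd n T) : Icc (0 : ℝ) T → E n) = fun t =>
        ext0 (f : Icc (0 : ℝ) T → E n) t + ext0 (g : Icc (0 : ℝ) T → E n) t := by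
      funext t
      by_cases ht : t ∈ Icc (0 : ℝ) T <;> simp [ext0, ht]
    rw [mem_ofPred_eq, h]
    refine ⟨fun t ht => ?_, fun t ht => ?_⟩
    · obtain ⟨l, hl⟩ := hf.1 t ht
      obtain ⟨m, hm⟩ := hg.1 t ht
      exact ⟨l + m, hl.add hm⟩
    · obtain ⟨l, hl⟩ := hf.2 t ht
      obtain ⟨m, hm⟩ := hg.2 t ht
      exact ⟨l + m, hl.add hm⟩
  smul_mem' := by
    intro c f hf
    have h : ext0 ((c • f : Bdd n T) : Icc (0 : ℝ) T → E n) = fun t =>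
        c • ext0 (f : Icc (0 : ℝ) T → E n) t := by
      funext t
      by_cases ht : t ∈ Icc (0 : ℝ) T <;> simp [ext0, ht]
    rw [mem_ofPred_eq, h]
    refine ⟨fun t ht => ?_, fun t ht => ?_⟩
    · obtain ⟨l, hl⟩ := hf.1 t ht
      exact ⟨c • l, hl.const_smul c⟩
    · obtain ⟨l, hl⟩ := hf.2 t ht
      exact ⟨c • l, hl.const_smul c⟩

/-- The normed space `G[0, T]`. -/
abbrev G (n : ℕ) (T : ℝ) : Type := regulatedSubmodule n T

/-- The value `x(t)`, for `t ∈ [0, T]`. -/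
def ev {n : ℕ} {T : ℝ} (x : G n T) (t : ℝ) : E n :=
  ext0 ((x : Bdd n T) : Icc (0 : ℝ) T → E n) t

/-- A regulated function on `[0, T]` as an element of `G[0, T]`. -/
def mkG {n : ℕ} {T : ℝ} (f : ℝ → E n) (hf : IsRegulated f 0 T) : G n T :=
  ⟨⟨fun t => f t, by
      obtain ⟨C, hC⟩ := hf.bounded
      refine memℓp_infty ⟨C, ?_⟩
      rintro _ ⟨t, rfl⟩
      exact hC t t.2⟩,
    hf.congr fun t ht => by simp only [ext0, dif_pos ht]⟩

/-! ### The periodic problem and its operator -/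

/-- `(x, lam)` solves `dx/dτ = DF(lam, x, t)`, `x(0) = x(T)`. -/
def IsPeriodicSolution {n : ℕ} {T : ℝ} (F : ℝ → E n → ℝ → E n) (Ω : Set (E n))
    (x : G n T) (lam : ℝ) : Prop :=
  (∀ s ∈ Icc 0 T, ev x s ∈ Ω ∧
    HasKurzweilIntegral (fun τ t => F lam (ev x τ) t) 0 s (ev x s - ev x 0)) ∧
  ev x 0 = ev x T

/-- `Φ(lam, x)(s) = x(T) + ∫_0^s DF(lam, x(τ), t)`. -/
def PhiFun {n : ℕ} {T : ℝ} (F : ℝ → E n → ℝ → E n) (lam : ℝ) (x : G n T) (s : ℝ) : E n :=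
  ev x T + kurzweilIntegral (fun τ t => F lam (ev x τ) t) 0 s

open Classical in
/-- The operator `Φ(lam, ·)` with values in `G[0, T]` (with value `0` where the function above is
not regulated). -/
def Phi {n : ℕ} {T : ℝ} (F : ℝ → E n → ℝ → E n) (lam : ℝ) (x : G n T) : G n T :=
  if h : IsRegulated (PhiFun F lam x) 0 T then mkG (PhiFun F lam x) h else 0

/-- `(x, lam) ∈ B(x₀, ρ) × Λ` satisfies `x = Φ(lam, x)`. -/
def SolvesOp {n : ℕ} {T : ℝ} (F : ℝ → E n → ℝ → E n) (Λ : Set ℝ) (x₀ : G n T) (ρ : ℝ)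
    (x : G n T) (lam : ℝ) : Prop :=
  x ∈ Metric.closedBall x₀ ρ ∧ lam ∈ Λ ∧ x = Phi F lam x

/-- `(y, μ)` is a bifurcation point of the equation `x = Φ(lam, x)` on `B(x₀, ρ) × Λ`. -/
def IsBifurcationPoint {n : ℕ} {T : ℝ} (F : ℝ → E n → ℝ → E n) (Λ : Set ℝ) (x₀ : G n T) (ρ : ℝ)
    (y : G n T) (μ : ℝ) : Prop :=
  SolvesOp F Λ x₀ ρ y μ ∧
    ∀ U ∈ 𝓝 (y, μ), ∃ x lam, (x, lam) ∈ U ∧ SolvesOp F Λ x₀ ρ x lam ∧ x ≠ y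

/-! ### Hypotheses on the right-hand side -/

/-- `ω : [0, ∞) → [0, ∞)` is increasing and continuous with `ω(0) = 0`. -/
def IsModulus (ω : ℝ → ℝ) : Prop :=
  StrictMonoOn ω (Ici 0) ∧ ContinuousOn ω (Ici 0) ∧ ω 0 = 0

/-- The class `𝓕(Ω × [0, T], h, ω; X)`. -/
def ClassF {V X : Type*} [NormedAddCommGroup V] [NormedAddCommGroup X]
    (Ω : Set V) (T : ℝ) (h ω : ℝ → ℝ) (f : V → ℝ → X) : Prop :=
  (∀ x ∈ Ω, ∀ t₁ ∈ Icc 0 T, ∀ t₂ ∈ Icc 0 T, ‖f x t₂ - f x t₁‖ ≤ |h t₂ - h t₁|) ∧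
  ∀ x ∈ Ω, ∀ y ∈ Ω, ∀ t₁ ∈ Icc 0 T, ∀ t₂ ∈ Icc 0 T,
    ‖f x t₂ - f x t₁ - f y t₂ + f y t₁‖ ≤ ω ‖x - y‖ * |h t₂ - h t₁|

/-- Increments of `f(lam, x, ·)` depend on `lam` uniformly continuously, relative to a
nondecreasing function `γ`. -/
def UniformInParameter {V X : Type*} [NormedAddCommGroup V] [NormedAddCommGroup X]
    (Λ : Set ℝ) (Ω : Set V) (T : ℝ) (f : ℝ → V → ℝ → X) : Prop :=
  ∃ γ : ℝ → ℝ, MonotoneOn γ (Icc 0 T) ∧ ∀ ε > 0, ∃ δ > 0,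
    ∀ x ∈ Ω, ∀ t ∈ Icc 0 T, ∀ s ∈ Icc 0 T, ∀ l₁ ∈ Λ, ∀ l₂ ∈ Λ, |l₁ - l₂| < δ →
      ‖f l₁ x t - f l₂ x t - f l₁ x s + f l₂ x s‖ ≤ ε * |γ t - γ s|

/-- The Jacobian matrix `F'_x(lam, x, t)`. Matrices carry the norm `max_i ∑_j |a_{ij}|`. -/
def jacobian {n : ℕ} (F : ℝ → E n → ℝ → E n) (lam : ℝ) (x : E n) (t : ℝ) :
    Matrix (Fin n) (Fin n) ℝ :=
  LinearMap.toMatrix (PiLp.basisFun 1 ℝ (Fin n)) (PiLp.basisFun 1 ℝ (Fin n))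
    (fderiv ℝ (fun y => F lam y t) x).toLinearMap

/-- `F(lam, ·, ·)` lies in one class `𝓕(Ω × [0, T], h, ω)` for all `lam ∈ Λ`. -/
def CondB1 {n : ℕ} (T : ℝ) (Λ : Set ℝ) (Ω : Set (E n)) (F : ℝ → E n → ℝ → E n) : Prop :=
  IsOpen Ω ∧ IsOpen Λ ∧ ∃ h ω : ℝ → ℝ, MonotoneOn h (Icc 0 T) ∧ IsModulus ω ∧
    ∀ lam ∈ Λ, ClassF Ω T h ω (F lam)

/-- `x₀` solves the periodic problem for every `lam ∈ Λ`, and all functions in `B(x₀, ρ)` have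
their values in `Ω`. -/
def CondB2 {n : ℕ} {T : ℝ} (Λ : Set ℝ) (Ω : Set (E n)) (F : ℝ → E n → ℝ → E n)
    (x₀ : G n T) (ρ : ℝ) : Prop :=
  (∀ lam ∈ Λ, IsPeriodicSolution F Ω x₀ lam) ∧ 0 < ρ ∧
    ∀ t ∈ Icc 0 T, ∀ x ∈ Metric.closedBall x₀ ρ, ev x t ∈ Ω

/-- Uniform continuity of `F` in the parameter. -/
def CondB3 {n : ℕ} (T : ℝ) (Λ : Set ℝ) (Ω : Set (E n)) (F : ℝ → E n → ℝ → E n) : Prop :=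
  UniformInParameter Λ Ω T F

/-- `F'_x` exists, is continuous in `x`, and lies in one class `𝓕(Ω × [0, T], h, ω; ℝⁿˣⁿ)` for all
`lam ∈ Λ`. -/
def CondC1 {n : ℕ} (T : ℝ) (Λ : Set ℝ) (Ω : Set (E n)) (F : ℝ → E n → ℝ → E n) : Prop :=
  (∀ lam ∈ Λ, ∀ x ∈ Ω, ∀ t ∈ Icc 0 T, DifferentiableAt ℝ (fun y => F lam y t) x) ∧
  (∀ lam ∈ Λ, ∀ t ∈ Icc 0 T, ContinuousOn (fun x => jacobian F lam x t) Ω) ∧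
  ∃ h ω : ℝ → ℝ, MonotoneOn h (Icc 0 T) ∧ (∀ t ∈ Icc 0 T, 0 ≤ h t) ∧ IsModulus ω ∧
    ∀ lam ∈ Λ, ClassF Ω T h ω (jacobian F lam)

/-- Uniform continuity of `F'_x` in the parameter. -/
def CondC3 {n : ℕ} (T : ℝ) (Λ : Set ℝ) (Ω : Set (E n)) (F : ℝ → E n → ℝ → E n) : Prop :=
  UniformInParameter Λ Ω T (jacobian F)

end GenODE

end

namespace GenODE

/-! ### Interval induction and uniqueness of the Kurzweil integral -/

/-! Since `x₀` is a fixed point of `Φ(λ, ·)` for every `λ`, bifurcation near `(x₀, λ₀)` would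
require nontrivial fixed points there. `norm_Phi_sub_Phi_sub_le` supplies one operator `A` with
`‖Φ(λ, x) - Φ(λ, x₀) - A (x - x₀)‖ ≤ ε ‖x - x₀‖` for all `x` near `x₀` and, uniformly, all `λ` near
`λ₀`. Taking `λ = λ₀` identifies `A` with the Fréchet derivative, so `Id - A` is invertible and `‖z‖
≤ c ‖z - A z‖`. For a fixed point `x` of `Φ(λ, ·)` the left side above is `‖(x - x₀) - A (x - x₀)‖`;
with `ε = 1 / (2c)` this gives `‖x - x₀‖ ≤ ‖x - x₀‖ / 2`, hence `x = x₀`.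

The estimate comes from the mean value inequality applied to the increments `F(λ, ·, v) - F(λ, ·,
u)`, which bounds the integrand by increments of a monotone function; the bound is then integrated.

Kurzweil integrals are handled through `ApproxPrimitive`: near each tag the increments of `I` match
those of `U` up to increments of a monotone function of small variation. This condition is local and
additive over adjacent intervals, so `interval_induction` yields both existence
(`exists_approxPrimitive`) and norm bounds (`ApproxPrimitive.norm_sub_le`). Along a fine partition
the errors telescope, which connects it with the gauge definition. -/

/-- A property of intervals that is additive and holds for short intervals to the left and to the
right of every point holds for the whole interval. -/
theorem interval_induction {a b : ℝ} (hab : a ≤ b) (P : ℝ → ℝ → Prop)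
    (hadd : ∀ c m d, a ≤ c → c ≤ m → m ≤ d → d ≤ b → P c m → P m d → P c d)
    (hleft : ∀ τ ∈ Icc a b, ∃ η > 0, ∀ c ∈ Icc a b, c ≤ τ → τ - η < c → P c τ)
    (hright : ∀ τ ∈ Icc a b, ∃ η > 0, ∀ d ∈ Icc a b, τ ≤ d → d < τ + η → P τ d) :
    P a b := by
  set S : Set ℝ := {s | s ∈ Icc a b ∧ P a s} with hS
  have haS : a ∈ S := by
    obtain ⟨η, hη, h⟩ := hright a ⟨le_rfl, hab⟩
    exact ⟨⟨le_rfl, hab⟩, h a ⟨le_rfl, hab⟩ le_rfl (by linarith)⟩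
  have hbdd : BddAbove S := ⟨b, fun s hs => hs.1.2⟩
  set c := sSup S with hc
  have hac : a ≤ c := le_csSup hbdd haS
  have hcb : c ≤ b := csSup_le ⟨a, haS⟩ fun s hs => hs.1.2
  -- The supremum is attained: some `s` in `S` lies within the left radius of `c`, and `[a, s]` and
  -- `[s, c]` are joined.
  have hcS : P a c := by
    obtain ⟨η, hη, h⟩ := hleft c ⟨hac, hcb⟩
    obtain ⟨s, hs, hcs⟩ := exists_lt_of_lt_csSup ⟨a, haS⟩ (show c - η < sSup S by linarith)
    have hsc : s ≤ c := le_csSup hbdd hs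
    exact hadd a s c le_rfl hs.1.1 hsc hcb hs.2 (h s hs.1 hsc hcs)
  rcases hcb.eq_or_lt with h | hlt
  · rwa [h] at hcS
  · exfalso
    obtain ⟨η, hη, h⟩ := hright c ⟨hac, hcb⟩
    have h1 : c < min (c + η / 2) b := lt_min (by linarith) hlt
    have h2 : min (c + η / 2) b ≤ b := min_le_right _ _
    have h3 : min (c + η / 2) b ≤ c + η / 2 := min_le_left _ _
    have hmem : min (c + η / 2) b ∈ Icc a b := ⟨by linarith, h2⟩
    have h4 : min (c + η / 2) b ∈ S :=
      ⟨hmem, hadd a c _ le_rfl hac h1.le h2 hcS (h _ hmem h1.le (by linarith))⟩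
    exact absurd (le_csSup hbdd h4) (not_le.2 h1)

theorem IsTaggedPartition.left_le {a b : ℝ} {ν : ℕ} {t τ : ℕ → ℝ}
    (h : IsTaggedPartition a b ν t τ) : ∀ j ≤ ν, a ≤ t j := by
  intro j
  induction j with
  | zero => intro _; exact h.1.ge
  | succ j ih => intro hj; exact (ih (by omega)).trans (h.2.2 j (by omega)).1

theorem IsTaggedPartition.le_right {a b : ℝ} {ν : ℕ} {t τ : ℕ → ℝ}
    (h : IsTaggedPartition a b ν t τ) : ∀ j ≤ ν, t j ≤ b := by
  intro j hj
  induction hj using Nat.decreasingInduction with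
  | self => exact h.2.1.le
  | of_succ k hk ih => exact (h.2.2 k hk).1.trans ih

/-- Cousin's lemma. -/
theorem exists_fine_partition {a b : ℝ} (hab : a ≤ b) {δ : ℝ → ℝ}
    (hδ : ∀ s ∈ Icc a b, 0 < δ s) :
    ∃ (ν : ℕ) (t τ : ℕ → ℝ), IsTaggedPartition a b ν t τ ∧ IsFine δ ν t τ := by
  have single : ∀ c τ d, c ≤ τ → τ ≤ d → τ - δ τ < c → d < τ + δ τ →
      ∃ (ν : ℕ) (t τ : ℕ → ℝ), IsTaggedPartition c d ν t τ ∧ IsFine δ ν t τ := by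
    intro c τ d h1 h2 h3 h4
    refine ⟨1, fun j => if j = 0 then c else d, fun _ => τ, ⟨by simp, by simp, ?_⟩, ?_⟩
    · intro j hj
      obtain rfl : j = 0 := by omega
      simp [h1, h2, h1.trans h2]
    · intro j hj
      obtain rfl : j = 0 := by omega
      simp only [if_true, zero_add, one_ne_zero, if_false]
      exact fun x hx => ⟨h3.trans_le hx.1, hx.2.trans_lt h4⟩
  refine interval_induction hab
    (fun c d => ∃ (ν : ℕ) (t τ : ℕ → ℝ), IsTaggedPartition c d ν t τ ∧ IsFine δ ν t τ)
    ?_ ?_ ?_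
  · rintro c m d - hcm hmd - ⟨ν₁, t₁, τ₁, ⟨h₁, h₁', h₁''⟩, f₁⟩ ⟨ν₂, t₂, τ₂, ⟨h₂, h₂', h₂''⟩, f₂⟩
    have e1 : ∀ j ≤ ν₁, (if j ≤ ν₁ then t₁ j else t₂ (j - ν₁)) = t₁ j := fun j hj => if_pos hj
    -- Both formulas apply at `j = ν₁`, since the first partition ends and the second begins at `m`.
    have e2 : ∀ j, ν₁ ≤ j → (if j ≤ ν₁ then t₁ j else t₂ (j - ν₁)) = t₂ (j - ν₁) := by
      intro j hj
      by_cases h : j ≤ ν₁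
      · obtain rfl : j = ν₁ := le_antisymm h hj
        simp [h₁', h₂]
      · exact if_neg h
    refine ⟨ν₁ + ν₂, fun j => if j ≤ ν₁ then t₁ j else t₂ (j - ν₁),
      fun j => if j < ν₁ then τ₁ j else τ₂ (j - ν₁), ⟨?_, ?_, ?_⟩, ?_⟩
    · simpa using h₁
    · beta_reduce
      rw [e2 (ν₁ + ν₂) (by omega), Nat.add_sub_cancel_left, h₂']
    · intro j hj
      by_cases h : j < ν₁
      · simp only [e1 j h.le, e1 (j + 1) h, if_pos h]
        exact h₁'' j h
      · beta_reduce
        rw [e2 j (by omega), e2 (j + 1) (by omega), if_neg h,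
          show j + 1 - ν₁ = (j - ν₁) + 1 by omega]
        exact h₂'' (j - ν₁) (by omega)
    · intro j hj
      by_cases h : j < ν₁
      · simp only [e1 j h.le, e1 (j + 1) h, if_pos h]
        exact f₁ j h
      · beta_reduce
        rw [e2 j (by omega), e2 (j + 1) (by omega), if_neg h,
          show j + 1 - ν₁ = (j - ν₁) + 1 by omega]
        exact f₂ (j - ν₁) (by omega)
  · intro τ hτ
    exact ⟨δ τ, hδ τ hτ, fun c _ h1 h2 => single c τ τ h1 le_rfl h2 (by linarith [hδ τ hτ])⟩
  · intro τ hτ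
    exact ⟨δ τ, hδ τ hτ, fun d _ h1 h2 => single τ τ d le_rfl h1 (by linarith [hδ τ hτ]) h2⟩

/-- By Cousin's lemma some partition is fine for both gauges, and its single sum is close to both
values. -/
theorem HasKurzweilIntegral.unique {X : Type*} [NormedAddCommGroup X] {U : ℝ → ℝ → X} {a b : ℝ}
    (hab : a ≤ b) {I J : X} (hI : HasKurzweilIntegral U a b I)
    (hJ : HasKurzweilIntegral U a b J) : I = J := by
  refine eq_of_forall_dist_le fun ε hε => ?_
  obtain ⟨δ₁, hδ₁, h₁⟩ := hI (ε / 2) (by linarith)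
  obtain ⟨δ₂, hδ₂, h₂⟩ := hJ (ε / 2) (by linarith)
  obtain ⟨ν, t, τ, hp, hf⟩ := exists_fine_partition hab (δ := fun s => min (δ₁ s) (δ₂ s))
    fun s hs => lt_min (hδ₁ s hs) (hδ₂ s hs)
  have k₁ := h₁ ν t τ hp fun j hj => (hf j hj).trans
    (Ioo_subset_Ioo (by linarith [min_le_left (δ₁ (τ j)) (δ₂ (τ j))])
      (by linarith [min_le_left (δ₁ (τ j)) (δ₂ (τ j))]))
  have k₂ := h₂ ν t τ hp fun j hj => (hf j hj).trans
    (Ioo_subset_Ioo (by linarith [min_le_right (δ₁ (τ j)) (δ₂ (τ j))])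
      (by linarith [min_le_right (δ₁ (τ j)) (δ₂ (τ j))]))
  rw [← dist_eq_norm, dist_comm] at k₁
  rw [← dist_eq_norm] at k₂
  linarith [dist_triangle I (∑ j ∈ Finset.range ν, (U (τ j) (t (j + 1)) - U (τ j) (t j))) J]

theorem HasKurzweilIntegral.kurzweilIntegral_eq {X : Type*} [NormedAddCommGroup X]
    {U : ℝ → ℝ → X} {a b : ℝ} (hab : a ≤ b) {I : X} (hI : HasKurzweilIntegral U a b I) :
    kurzweilIntegral U a b = I := by
  have h : ∃ I, HasKurzweilIntegral U a b I := ⟨I, hI⟩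
  rw [kurzweilIntegral, dif_pos h]
  exact h.choose_spec.unique hab hI

/-! ### Approximate primitives -/

/-- `I` is a primitive of `U` on `[a, b]` up to an error that is controlled by a nondecreasing
function of total variation at most `ε`. -/
def ApproxPrimitive {X : Type*} [NormedAddCommGroup X] (U : ℝ → ℝ → X) (a b ε : ℝ)
    (I : ℝ → X) : Prop :=
  ∃ g : ℝ → ℝ, MonotoneOn g (Icc a b) ∧ g b - g a ≤ ε ∧ ∀ τ ∈ Icc a b, ∃ δ > 0,
    ∀ u ∈ Icc a b, ∀ v ∈ Icc a b, u ≤ τ → τ ≤ v → τ - δ < u → v < τ + δ →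
      ‖I v - I u - (U τ v - U τ u)‖ ≤ g v - g u

/-- `J s = ∫_a^s DU(τ, t)` for all `s ∈ [a, b]`, where the integral is a limit of approximate
primitives. -/
def IsIndefiniteIntegral {X : Type*} [NormedAddCommGroup X] (U : ℝ → ℝ → X) (a b : ℝ)
    (J : ℝ → X) : Prop :=
  ∀ ε > 0, ∃ I, ApproxPrimitive U a b ε I ∧ ∀ s ∈ Icc a b, ‖I s - I a - J s‖ ≤ ε

section

variable {X : Type*} [NormedAddCommGroup X] {U V : ℝ → ℝ → X} {a b : ℝ}

theorem ApproxPrimitive.mono {I : ℝ → X} {ε ε' : ℝ} (h : ApproxPrimitive U a b ε I)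
    (hε : ε ≤ ε') : ApproxPrimitive U a b ε' I := by
  obtain ⟨g, hg, hgε, hI⟩ := h
  exact ⟨g, hg, hgε.trans hε, hI⟩

theorem ApproxPrimitive.sub {I J : ℝ → X} {ε ε' : ℝ} (hI : ApproxPrimitive U a b ε I)
    (hJ : ApproxPrimitive V a b ε' J) :
    ApproxPrimitive (fun τ t => U τ t - V τ t) a b (ε + ε') (fun t => I t - J t) := by
  obtain ⟨g, hg, hgε, h⟩ := hI
  obtain ⟨g', hg', hgε', h'⟩ := hJ
  refine ⟨fun t => g t + g' t, hg.add hg', by linarith, fun τ hτ => ?_⟩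
  obtain ⟨δ, hδ, k⟩ := h τ hτ
  obtain ⟨δ', hδ', k'⟩ := h' τ hτ
  refine ⟨min δ δ', lt_min hδ hδ', fun u hu v hv h1 h2 h3 h4 => ?_⟩
  have m1 := min_le_left δ δ'
  have m2 := min_le_right δ δ'
  have e1 := k u hu v hv h1 h2 (by linarith) (by linarith)
  have e2 := k' u hu v hv h1 h2 (by linarith) (by linarith)
  calc _ = ‖(I v - I u - (U τ v - U τ u)) - (J v - J u - (V τ v - V τ u))‖ := by
        congr 1; beta_reduce; abel
    _ ≤ _ := (norm_sub_le _ _).trans (by linarith)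

theorem ApproxPrimitive.add {I J : ℝ → X} {ε ε' : ℝ} (hI : ApproxPrimitive U a b ε I)
    (hJ : ApproxPrimitive V a b ε' J) :
    ApproxPrimitive (fun τ t => U τ t + V τ t) a b (ε + ε') (fun t => I t + J t) := by
  obtain ⟨g, hg, hgε, h⟩ := hI
  obtain ⟨g', hg', hgε', h'⟩ := hJ
  refine ⟨fun t => g t + g' t, hg.add hg', by linarith, fun τ hτ => ?_⟩
  obtain ⟨δ, hδ, k⟩ := h τ hτ
  obtain ⟨δ', hδ', k'⟩ := h' τ hτ
  refine ⟨min δ δ', lt_min hδ hδ', fun u hu v hv h1 h2 h3 h4 => ?_⟩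
  have m1 := min_le_left δ δ'
  have m2 := min_le_right δ δ'
  have e1 := k u hu v hv h1 h2 (by linarith) (by linarith)
  have e2 := k' u hu v hv h1 h2 (by linarith) (by linarith)
  calc _ = ‖(I v - I u - (U τ v - U τ u)) + (J v - J u - (V τ v - V τ u))‖ := by
        congr 1; beta_reduce; abel
    _ ≤ _ := (norm_add_le _ _).trans (by linarith)

/-- An approximate primitive inherits a bound on the increments of `U(τ, ·)`. -/
theorem ApproxPrimitive.norm_sub_le {I : ℝ → X} {ε : ℝ} (h : ApproxPrimitive U a b ε I)
    {k : ℝ → ℝ} (hk : ∀ τ ∈ Icc a b, ∀ u ∈ Icc a b, ∀ v ∈ Icc a b, u ≤ τ → τ ≤ v →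
      ‖U τ v - U τ u‖ ≤ k v - k u)
    {s t : ℝ} (hs : s ∈ Icc a b) (ht : t ∈ Icc a b) (hst : s ≤ t) :
    ‖I t - I s‖ ≤ k t - k s + ε := by
  obtain ⟨g, hg, hgε, hI⟩ := h
  have hsub : Icc s t ⊆ Icc a b := Icc_subset_Icc hs.1 ht.2
  have hab : a ≤ b := hs.1.trans hs.2
  -- Interval induction needs a bound additive over adjacent intervals, so the error is kept as an
  -- increment of `g` and replaced by `ε` only at the end.
  have key : ‖I t - I s‖ ≤ (k t + g t) - (k s + g s) := by
    refine interval_induction hst (fun c d => ‖I d - I c‖ ≤ (k d + g d) - (k c + g c)) ?_ ?_ ?_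
    · intro c m d _ _ _ _ h1 h2
      calc _ = ‖(I m - I c) + (I d - I m)‖ := by congr 1; abel
        _ ≤ _ := (norm_add_le _ _).trans (by linarith)
    · intro τ hτ
      obtain ⟨δ, hδ, H⟩ := hI τ (hsub hτ)
      refine ⟨δ, hδ, fun c hc h1 h2 => ?_⟩
      have e1 := H c (hsub hc) τ (hsub hτ) h1 le_rfl h2 (by linarith)
      have e2 := hk τ (hsub hτ) c (hsub hc) τ (hsub hτ) h1 le_rfl
      calc _ = ‖(I τ - I c - (U τ τ - U τ c)) + (U τ τ - U τ c)‖ := by congr 1; abel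
        _ ≤ _ := (norm_add_le _ _).trans (by linarith)
    · intro τ hτ
      obtain ⟨δ, hδ, H⟩ := hI τ (hsub hτ)
      refine ⟨δ, hδ, fun d hd h1 h2 => ?_⟩
      have e1 := H τ (hsub hτ) d (hsub hd) le_rfl h1 (by linarith) h2
      have e2 := hk τ (hsub hτ) τ (hsub hτ) d (hsub hd) le_rfl h1
      calc _ = ‖(I d - I τ - (U τ d - U τ τ)) + (U τ d - U τ τ)‖ := by congr 1; abel
        _ ≤ _ := (norm_add_le _ _).trans (by linarith)
  have g1 := hg ⟨le_rfl, hab⟩ hs hs.1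
  have g2 := hg ht ⟨hab, le_rfl⟩ ht.2
  linarith

theorem IsIndefiniteIntegral.sub {J K : ℝ → X} (hJ : IsIndefiniteIntegral U a b J)
    (hK : IsIndefiniteIntegral V a b K) :
    IsIndefiniteIntegral (fun τ t => U τ t - V τ t) a b (fun t => J t - K t) := by
  intro ε hε
  obtain ⟨I, hI, h⟩ := hJ (ε / 2) (by linarith)
  obtain ⟨I', hI', h'⟩ := hK (ε / 2) (by linarith)
  refine ⟨_, (hI.sub hI').mono (by linarith), fun s hs => ?_⟩
  calc _ = ‖(I s - I a - J s) - (I' s - I' a - K s)‖ := by congr 1; beta_reduce; abel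
    _ ≤ _ := (_root_.norm_sub_le _ _).trans (by linarith [h s hs, h' s hs])

theorem IsIndefiniteIntegral.add {J K : ℝ → X} (hJ : IsIndefiniteIntegral U a b J)
    (hK : IsIndefiniteIntegral V a b K) :
    IsIndefiniteIntegral (fun τ t => U τ t + V τ t) a b (fun t => J t + K t) := by
  intro ε hε
  obtain ⟨I, hI, h⟩ := hJ (ε / 2) (by linarith)
  obtain ⟨I', hI', h'⟩ := hK (ε / 2) (by linarith)
  refine ⟨_, (hI.add hI').mono (by linarith), fun s hs => ?_⟩
  calc _ = ‖(I s - I a - J s) + (I' s - I' a - K s)‖ := by congr 1; beta_reduce; abel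
    _ ≤ _ := (norm_add_le _ _).trans (by linarith [h s hs, h' s hs])

theorem IsIndefiniteIntegral.const_smul [NormedSpace ℝ X] {J : ℝ → X} (c : ℝ)
    (hJ : IsIndefiniteIntegral U a b J) :
    IsIndefiniteIntegral (fun τ t => c • U τ t) a b (fun t => c • J t) := by
  intro ε hε
  -- The added `1` covers `c = 0`.
  have hc : 0 < |c| + 1 := by positivity
  obtain ⟨I, ⟨g, hg, hgε, hI⟩, h⟩ := hJ (ε / (|c| + 1)) (by positivity)
  have hcε : |c| * (ε / (|c| + 1)) ≤ ε := by
    rw [mul_div_assoc', div_le_iff₀ hc]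
    nlinarith [abs_nonneg c]
  refine ⟨fun t => c • I t, ⟨fun t => |c| * g t,
    fun s hs t ht hst => mul_le_mul_of_nonneg_left (hg hs ht hst) (abs_nonneg c), ?_,
    fun τ hτ => ?_⟩, fun s hs => ?_⟩
  · rw [← mul_sub]
    exact (mul_le_mul_of_nonneg_left hgε (abs_nonneg c)).trans hcε
  · obtain ⟨δ, hδ, k⟩ := hI τ hτ
    refine ⟨δ, hδ, fun u hu v hv h1 h2 h3 h4 => ?_⟩
    rw [← smul_sub, ← smul_sub, ← smul_sub, norm_smul, Real.norm_eq_abs, ← mul_sub]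
    exact mul_le_mul_of_nonneg_left (k u hu v hv h1 h2 h3 h4) (abs_nonneg c)
  · rw [← smul_sub, ← smul_sub, norm_smul, Real.norm_eq_abs]
    exact (mul_le_mul_of_nonneg_left (h s hs) (abs_nonneg c)).trans hcε

theorem IsIndefiniteIntegral.norm_sub_le {J : ℝ → X} (h : IsIndefiniteIntegral U a b J)
    {k : ℝ → ℝ} (hk : ∀ τ ∈ Icc a b, ∀ u ∈ Icc a b, ∀ v ∈ Icc a b, u ≤ τ → τ ≤ v →
      ‖U τ v - U τ u‖ ≤ k v - k u)
    {s t : ℝ} (hs : s ∈ Icc a b) (ht : t ∈ Icc a b) (hst : s ≤ t) :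
    ‖J t - J s‖ ≤ k t - k s := by
  refine le_of_forall_pos_le_add fun ε hε => ?_
  obtain ⟨I, hI, hIJ⟩ := h (ε / 3) (by linarith)
  calc _ = ‖(I t - I s) - (I t - I a - J t) + (I s - I a - J s)‖ := by congr 1; abel
    _ ≤ _ := (norm_add_le _ _).trans (by
      linarith [_root_.norm_sub_le (I t - I s) (I t - I a - J t), hIJ s hs, hIJ t ht,
        hI.norm_sub_le hk hs ht hst])

theorem IsIndefiniteIntegral.apply_left {J : ℝ → X} (h : IsIndefiniteIntegral U a b J)
    (hab : a ≤ b) : J a = 0 := by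
  rw [← norm_le_zero_iff]
  refine le_of_forall_pos_le_add fun ε hε => ?_
  obtain ⟨I, -, hI⟩ := h ε hε
  simpa using hI a ⟨le_rfl, hab⟩

/-- The radii attached to the tags form a gauge. Along a fine partition the increments of `I`
telescope, and so do the error bounds, whose total is at most `g b - g a`. -/
theorem IsIndefiniteIntegral.hasKurzweilIntegral {J : ℝ → X} (h : IsIndefiniteIntegral U a b J)
    {s : ℝ} (hs : s ∈ Icc a b) : HasKurzweilIntegral U a s (J s) := by
  intro ε hε
  obtain ⟨I, ⟨g, hg, hgε, hI⟩, hIJ⟩ := h (ε / 3) (by linarith)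
  have hab : a ≤ b := hs.1.trans hs.2
  have hsub : Icc a s ⊆ Icc a b := Icc_subset_Icc_right hs.2
  -- The value `0` outside `[a, b]` is harmless: positivity is required only on `[a, s]`, where all
  -- tags lie.
  have hδ : ∀ τ : ℝ, ∃ δ : ℝ, τ ∈ Icc a b → 0 < δ ∧
      ∀ u ∈ Icc a b, ∀ v ∈ Icc a b, u ≤ τ → τ ≤ v → τ - δ < u → v < τ + δ →
      ‖I v - I u - (U τ v - U τ u)‖ ≤ g v - g u := by
    intro τ
    by_cases hτ : τ ∈ Icc a b
    · obtain ⟨δ, hδ, k⟩ := hI τ hτ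
      exact ⟨δ, fun _ => ⟨hδ, k⟩⟩
    · exact ⟨0, fun h => absurd h hτ⟩
  choose δ hδ using hδ
  refine ⟨δ, fun τ hτ => (hδ τ (hsub hτ)).1, fun ν t τ hp hf => ?_⟩
  have hmem : ∀ j ≤ ν, t j ∈ Icc a b := fun j hj => hsub ⟨hp.left_le j hj, hp.le_right j hj⟩
  have hI' : I s - I a = ∑ j ∈ Finset.range ν, (I (t (j + 1)) - I (t j)) := by
    rw [Finset.sum_range_sub (fun j => I (t j)), hp.1, hp.2.1]
  have hg' : g s - g a = ∑ j ∈ Finset.range ν, (g (t (j + 1)) - g (t j)) := by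
    rw [Finset.sum_range_sub (fun j => g (t j)), hp.1, hp.2.1]
  have key : ‖(I s - I a) - ∑ j ∈ Finset.range ν, (U (τ j) (t (j + 1)) - U (τ j) (t j))‖
      ≤ g s - g a := by
    rw [hI', hg', ← Finset.sum_sub_distrib]
    refine norm_sum_le_of_le _ fun j hj => ?_
    have hj' : j < ν := Finset.mem_range.1 hj
    obtain ⟨h1, h2⟩ := hp.2.2 j hj'
    have m1 := hmem j hj'.le
    have m2 := hmem (j + 1) hj'
    exact (hδ (τ j) ⟨m1.1.trans h2.1, h2.2.trans m2.2⟩).2 _ m1 _ m2 h2.1 h2.2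
      (hf j hj' ⟨le_rfl, h1⟩).1 (hf j hj' ⟨h1, le_rfl⟩).2
  have g2 := hg hs ⟨hab, le_rfl⟩ hs.2
  calc _ = ‖(I s - I a - J s) - ((I s - I a) -
        ∑ j ∈ Finset.range ν, (U (τ j) (t (j + 1)) - U (τ j) (t j)))‖ := by congr 1; abel
    _ < ε := (_root_.norm_sub_le _ _).trans_lt (by linarith [hIJ s hs])

theorem IsIndefiniteIntegral.kurzweilIntegral_eq {J : ℝ → X}
    (h : IsIndefiniteIntegral U a b J) {s : ℝ} (hs : s ∈ Icc a b) :
    kurzweilIntegral U a s = J s :=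
  (h.hasKurzweilIntegral hs).kurzweilIntegral_eq hs.1

theorem IsIndefiniteIntegral.congr {J : ℝ → X} (h : IsIndefiniteIntegral U a b J)
    (hUV : ∀ τ ∈ Icc a b, ∀ t ∈ Icc a b, U τ t = V τ t) : IsIndefiniteIntegral V a b J := by
  intro ε hε
  obtain ⟨I, ⟨g, hg, hgε, hI⟩, hIJ⟩ := h ε hε
  refine ⟨I, ⟨g, hg, hgε, fun τ hτ => ?_⟩, hIJ⟩
  obtain ⟨δ, hδ, k⟩ := hI τ hτ
  refine ⟨δ, hδ, fun u hu v hv => ?_⟩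
  rw [← hUV τ hτ u hu, ← hUV τ hτ v hv]
  exact k u hu v hv

theorem ApproxPrimitive.glue {I₁ I₂ : ℝ → X} {ε₁ ε₂ m : ℝ} (ham : a ≤ m) (hmb : m ≤ b)
    (h₁ : ApproxPrimitive U a m ε₁ I₁) (h₂ : ApproxPrimitive U m b ε₂ I₂) :
    ApproxPrimitive U a b (ε₁ + ε₂) (fun t => I₁ (min t m) + I₂ (max t m)) := by
  obtain ⟨g₁, hg₁, hgε₁, H₁⟩ := h₁
  obtain ⟨g₂, hg₂, hgε₂, H₂⟩ := h₂
  refine ⟨fun t => g₁ (min t m) + g₂ (max t m), ?_, ?_, ?_⟩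
  · intro s hs t ht hst
    exact add_le_add
      (hg₁ ⟨le_min hs.1 ham, min_le_right _ _⟩ ⟨le_min ht.1 ham, min_le_right _ _⟩
        (min_le_min_right m hst))
      (hg₂ ⟨le_max_right _ _, max_le hs.2 hmb⟩ ⟨le_max_right _ _, max_le ht.2 hmb⟩
        (max_le_max_right m hst))
  · simp only [min_eq_right hmb, max_eq_left hmb, min_eq_left ham, max_eq_right ham]
    linarith
  · intro τ hτ
    rcases lt_trichotomy τ m with h | h | h
    · obtain ⟨δ, hδ, k⟩ := H₁ τ ⟨hτ.1, h.le⟩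
      refine ⟨min δ (m - τ), lt_min hδ (by linarith), fun u hu v hv h1 h2 h3 h4 => ?_⟩
      have m1 := min_le_left δ (m - τ)
      have m2 := min_le_right δ (m - τ)
      have hu' : u ≤ m := by linarith
      have hv' : v ≤ m := by linarith
      simp only [min_eq_left hu', min_eq_left hv', max_eq_right hu', max_eq_right hv',
        add_sub_add_right_eq_sub]
      exact k u ⟨hu.1, hu'⟩ v ⟨hv.1, hv'⟩ h1 h2 (by linarith) (by linarith)
    -- At the junction `τ = m` the interval `[u, v]` is split at its own tag, each half being
    -- controlled by one side.
    · obtain ⟨δ₁, hδ₁, k₁⟩ := H₁ τ ⟨hτ.1, h.le⟩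
      obtain ⟨δ₂, hδ₂, k₂⟩ := H₂ τ ⟨h.ge, hτ.2⟩
      subst h
      refine ⟨min δ₁ δ₂, lt_min hδ₁ hδ₂, fun u hu v hv h1 h2 h3 h4 => ?_⟩
      have m1 := min_le_left δ₁ δ₂
      have m2 := min_le_right δ₁ δ₂
      simp only [min_eq_left h1, min_eq_right h2, max_eq_right h1, max_eq_left h2]
      have e1 := k₁ u ⟨hu.1, h1⟩ τ ⟨ham, le_rfl⟩ h1 le_rfl (by linarith) (by linarith)
      have e2 := k₂ τ ⟨le_rfl, hmb⟩ v ⟨h2, hv.2⟩ le_rfl h2 (by linarith) (by linarith)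
      calc _ = ‖(I₁ τ - I₁ u - (U τ τ - U τ u)) + (I₂ v - I₂ τ - (U τ v - U τ τ))‖ := by
            congr 1; abel
        _ ≤ _ := (norm_add_le _ _).trans (by linarith)
    · obtain ⟨δ, hδ, k⟩ := H₂ τ ⟨h.le, hτ.2⟩
      refine ⟨min δ (τ - m), lt_min hδ (by linarith), fun u hu v hv h1 h2 h3 h4 => ?_⟩
      have m1 := min_le_left δ (τ - m)
      have m2 := min_le_right δ (τ - m)
      have hu' : m ≤ u := by linarith
      have hv' : m ≤ v := by linarith
      simp only [min_eq_right hu', min_eq_right hv', max_eq_left hu', max_eq_left hv',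
        add_sub_add_left_eq_sub]
      exact k u ⟨hu', hu.2⟩ v ⟨hv', hv.2⟩ h1 h2 (by linarith) (by linarith)

end

/-! ### Existence of the Kurzweil integral -/

/-- A monotone function has a right limit at `τ`; the point `τ` itself is excluded because `h` may
jump there. -/
theorem exists_small_increment_right {h : ℝ → ℝ} {a b : ℝ}
    (hh : MonotoneOn h (Icc a b)) {τ : ℝ} (hτ : τ ∈ Ico a b) {ε : ℝ} (hε : 0 < ε) :
    ∃ t₀ ∈ Ioc τ b, ∀ u ∈ Ioc τ t₀, ∀ v ∈ Ioc τ t₀, h v - h u ≤ ε := by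
  have hsub : Ioc τ b ⊆ Icc a b := fun x hx => ⟨hτ.1.trans hx.1.le, hx.2⟩
  have hne : (h '' Ioc τ b).Nonempty := ⟨_, mem_image_of_mem h ⟨hτ.2, le_rfl⟩⟩
  have hbdd : BddBelow (h '' Ioc τ b) := by
    refine ⟨h τ, ?_⟩
    rintro _ ⟨x, hx, rfl⟩
    exact hh ⟨hτ.1, hτ.2.le⟩ (hsub hx) hx.1.le
  obtain ⟨_, ⟨t₀, ht₀, rfl⟩, hlt⟩ := exists_lt_of_csInf_lt hne (lt_add_of_pos_right _ hε)
  refine ⟨t₀, ht₀, fun u hu v hv => ?_⟩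
  have h1 := csInf_le hbdd (mem_image_of_mem h (show u ∈ Ioc τ b from ⟨hu.1, hu.2.trans ht₀.2⟩))
  have h2 := hh (hsub ⟨hv.1, hv.2.trans ht₀.2⟩) (hsub ht₀) hv.2
  linarith

theorem exists_small_increment_left {h : ℝ → ℝ} {a b : ℝ}
    (hh : MonotoneOn h (Icc a b)) {τ : ℝ} (hτ : τ ∈ Ioc a b) {ε : ℝ} (hε : 0 < ε) :
    ∃ t₀ ∈ Ico a τ, ∀ u ∈ Ico t₀ τ, ∀ v ∈ Ico t₀ τ, h v - h u ≤ ε := by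
  have hsub : Ico a τ ⊆ Icc a b := fun x hx => ⟨hx.1, hx.2.le.trans hτ.2⟩
  have hne : (h '' Ico a τ).Nonempty := ⟨_, mem_image_of_mem h ⟨le_rfl, hτ.1⟩⟩
  have hbdd : BddAbove (h '' Ico a τ) := by
    refine ⟨h τ, ?_⟩
    rintro _ ⟨x, hx, rfl⟩
    exact hh (hsub hx) ⟨hτ.1.le, hτ.2⟩ hx.2.le
  obtain ⟨_, ⟨t₀, ht₀, rfl⟩, hlt⟩ := exists_lt_of_lt_csSup hne (sub_lt_self _ hε)
  refine ⟨t₀, ht₀, fun u hu v hv => ?_⟩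
  have h1 := le_csSup hbdd (mem_image_of_mem h (show v ∈ Ico a τ from ⟨ht₀.1.trans hv.1, hv.2⟩))
  have h2 := hh (hsub ht₀) (hsub ⟨ht₀.1.trans hu.1, hu.2⟩) hu.1
  linarith

section

variable {X : Type*} [NormedAddCommGroup X]

theorem exists_norm_sub_lt_of_tendsto {f : ℝ → X} {F : Filter ℝ} {l : X}
    (hl : Tendsto f F (𝓝 l)) {ε : ℝ} (hε : 0 < ε) :
    ∃ S ∈ F, ∀ s ∈ S, ∀ t ∈ S, ‖f s - f t‖ < ε := by
  refine ⟨f ⁻¹' Metric.ball l (ε / 2), hl (Metric.ball_mem_nhds _ (by linarith)),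
    fun s hs t ht => ?_⟩
  have h1 : dist (f s) l < ε / 2 := hs
  have h2 : dist (f t) l < ε / 2 := ht
  rw [← dist_eq_norm]
  linarith [dist_triangle_right (f s) (f t) l]

theorem IsRegulated.exists_osc_right {f : ℝ → X} {a b : ℝ} (hf : IsRegulated f a b) {τ : ℝ}
    (hτ : τ ∈ Ico a b) {ε : ℝ} (hε : 0 < ε) :
    ∃ η > 0, ∀ s ∈ Ioo τ (τ + η), ∀ t ∈ Ioo τ (τ + η), ‖f s - f t‖ < ε := by
  obtain ⟨l, hl⟩ := hf.2 τ hτ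
  obtain ⟨S, hS, h⟩ := exists_norm_sub_lt_of_tendsto hl hε
  obtain ⟨u, hu, hsub⟩ := mem_nhdsGT_iff_exists_Ioo_subset.1 hS
  refine ⟨u - τ, sub_pos.2 hu, fun s hs t ht => h s (hsub ?_) t (hsub ?_)⟩
  · simpa using hs
  · simpa using ht

theorem IsRegulated.exists_osc_left {f : ℝ → X} {a b : ℝ} (hf : IsRegulated f a b) {τ : ℝ}
    (hτ : τ ∈ Ioc a b) {ε : ℝ} (hε : 0 < ε) :
    ∃ η > 0, ∀ s ∈ Ioo (τ - η) τ, ∀ t ∈ Ioo (τ - η) τ, ‖f s - f t‖ < ε := by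
  obtain ⟨l, hl⟩ := hf.1 τ hτ
  obtain ⟨S, hS, h⟩ := exists_norm_sub_lt_of_tendsto hl hε
  obtain ⟨u, hu, hsub⟩ := mem_nhdsLT_iff_exists_Ioo_subset.1 hS
  refine ⟨τ - u, sub_pos.2 hu, fun s hs t ht => h s (hsub ?_) t (hsub ?_)⟩
  · simpa using hs
  · simpa using ht

theorem IsRegulated.prodMk {Y : Type*} [NormedAddCommGroup Y] {f : ℝ → X} {g : ℝ → Y} {a b : ℝ}
    (hf : IsRegulated f a b) (hg : IsRegulated g a b) :
    IsRegulated (fun t => (f t, g t)) a b := by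
  refine ⟨fun t ht => ?_, fun t ht => ?_⟩
  · obtain ⟨l, hl⟩ := hf.1 t ht
    obtain ⟨m, hm⟩ := hg.1 t ht
    exact ⟨(l, m), hl.prodMk_nhds hm⟩
  · obtain ⟨l, hl⟩ := hf.2 t ht
    obtain ⟨m, hm⟩ := hg.2 t ht
    exact ⟨(l, m), hl.prodMk_nhds hm⟩

/-- A function whose increments are dominated by those of a nondecreasing function is
regulated. -/
theorem isRegulated_of_norm_sub_le [CompleteSpace X] {f : ℝ → X} {k : ℝ → ℝ} {a b : ℝ}
    (hk : MonotoneOn k (Icc a b))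
    (hf : ∀ s ∈ Icc a b, ∀ t ∈ Icc a b, s ≤ t → ‖f t - f s‖ ≤ k t - k s) :
    IsRegulated f a b := by
  have key : ∀ F : Filter ℝ, F.NeBot → (∀ ε > 0, ∃ S ∈ F, S ⊆ Icc a b ∧
      ∀ u ∈ S, ∀ v ∈ S, k v - k u ≤ ε) → ∃ l, Tendsto f F (𝓝 l) := by
    intro F hF h
    suffices hc : Cauchy (map f F) from CompleteSpace.complete hc
    refine Metric.cauchy_iff.2 ⟨inferInstance, fun ε hε => ?_⟩
    obtain ⟨S, hS, hsub, hosc⟩ := h (ε / 2) (by linarith)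
    refine ⟨f '' S, image_mem_map hS, ?_⟩
    rintro _ ⟨u, hu, rfl⟩ _ ⟨v, hv, rfl⟩
    rcases le_total u v with huv | huv
    · rw [dist_comm, dist_eq_norm]
      linarith [hf u (hsub hu) v (hsub hv) huv, hosc u hu v hv]
    · rw [dist_eq_norm]
      linarith [hf v (hsub hv) u (hsub hu) huv, hosc v hv u hu]
  refine ⟨fun τ hτ => key _ inferInstance fun ε hε => ?_,
    fun τ hτ => key _ inferInstance fun ε hε => ?_⟩
  · obtain ⟨t₀, ht₀, h⟩ := exists_small_increment_left hk hτ hε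
    exact ⟨Ico t₀ τ, Ico_mem_nhdsLT ht₀.2,
      fun x hx => ⟨ht₀.1.trans hx.1, hx.2.le.trans hτ.2⟩, h⟩
  · obtain ⟨t₀, ht₀, h⟩ := exists_small_increment_right hk hτ hε
    exact ⟨Ioc τ t₀, Ioc_mem_nhdsGT ht₀.1,
      fun x hx => ⟨hτ.1.trans hx.1.le, hx.2.trans ht₀.2⟩, h⟩

variable {U : ℝ → ℝ → X} {a b : ℝ} {h : ℝ → ℝ}

/-- With the tag frozen at `d`, the function `U d` is a primitive on `(τ, d]` up to `ε * h`, by the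
oscillation hypothesis; only the value at `τ` needs correction. The error is an increment of `ε * (h
t + t)`, hence additive under gluing however many pieces occur, and the summand `t` pays for the
correction. -/
theorem exists_approxPrimitive_right (hh : MonotoneOn h (Icc a b))
    (hU : ∀ τ ∈ Icc a b, ∀ u ∈ Icc a b, ∀ v ∈ Icc a b, u ≤ v → ‖U τ v - U τ u‖ ≤ h v - h u)
    {ε τ d : ℝ} (hε : 0 < ε) (hτ : a ≤ τ) (hd : d ≤ b) (hτd : τ < d)
    (hosc : ∀ σ ∈ Ioc τ d, ∀ u ∈ Icc a b, ∀ v ∈ Icc a b, u ≤ v →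
      ‖(U d v - U d u) - (U σ v - U σ u)‖ ≤ ε * (h v - h u)) :
    ∃ I, ApproxPrimitive U τ d (ε * ((h d + d) - (h τ + τ))) I := by
  have hsub : Icc τ d ⊆ Icc a b := Icc_subset_Icc hτ hd
  obtain ⟨t₀, ht₀, hsmall⟩ := exists_small_increment_right hh
    (show τ ∈ Ico a b from ⟨hτ, hτd.trans_le hd⟩) (show 0 < ε * (d - τ) / 2 by
      have := mul_pos hε (sub_pos.2 hτd); linarith)
  have ht₀b : t₀ ∈ Icc a b := ⟨hτ.trans ht₀.1.le, ht₀.2⟩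
  have hτd' : 0 < ε * (d - τ) := mul_pos hε (sub_pos.2 hτd)
  have hd' : d ∈ Icc a b := hsub ⟨hτd.le, le_rfl⟩
  have hτ' : τ ∈ Icc a b := hsub ⟨le_rfl, hτd.le⟩
  -- The value at `τ` makes the increment from `τ` to `t₀` exact for the tag `τ`. For `v` in `(τ,
  -- t₀)` the two discrepancies are at most `ε * (d - τ) / 2` each, which is what the jump of the
  -- control function after `τ` absorbs.
  refine ⟨fun t => if τ < t then U d t - U d t₀ else -(U τ t₀ - U τ τ),
    fun t => ε * h t + if τ < t then ε * (d - τ) else 0, ?_, ?_, ?_⟩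
  · intro s hs t ht hst
    have h1 := mul_le_mul_of_nonneg_left (hh (hsub hs) (hsub ht) hst) hε.le
    beta_reduce
    split_ifs with h2 h3 h3
    · linarith
    · exact absurd (h2.trans_le hst) h3
    · linarith
    · linarith
  · simp only [hτd, if_true, lt_irrefl, if_false]
    exact le_of_eq (by ring)
  · intro σ hσ
    rcases hσ.1.eq_or_lt with rfl | hlt
    · refine ⟨t₀ - τ, sub_pos.2 ht₀.1, fun u hu v hv h1 h2 h3 h4 => ?_⟩
      obtain rfl : u = τ := le_antisymm h1 hu.1
      simp only [lt_irrefl, if_false]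
      rcases h2.eq_or_lt with rfl | h2
      · simp
      · simp only [h2, if_true]
        have hvt : v ≤ t₀ := by linarith
        have e1 := hU d hd' v (hsub hv) t₀ ht₀b hvt
        have e2 := hU u hτ' v (hsub hv) t₀ ht₀b hvt
        have e3 := hsmall v ⟨h2, hvt⟩ t₀ ⟨ht₀.1, le_rfl⟩
        have e4 := mul_le_mul_of_nonneg_left (hh hτ' (hsub hv) h2.le) hε.le
        calc _ = ‖(U u t₀ - U u v) - (U d t₀ - U d v)‖ := by congr 1; abel
          _ ≤ _ := (norm_sub_le _ _).trans (by linarith)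
    -- This radius keeps `u` to the right of `τ`, where the frozen formula is valid.
    · refine ⟨σ - τ, sub_pos.2 hlt, fun u hu v hv h1 h2 h3 h4 => ?_⟩
      have hu' : τ < u := by linarith
      have hv' : τ < v := by linarith
      simp only [hu', hv', if_true]
      have e := hosc σ ⟨hlt, hσ.2⟩ u (hsub hu) v (hsub hv) (h1.trans h2)
      calc _ = ‖(U d v - U d u) - (U σ v - U σ u)‖ := by congr 1; abel
        _ ≤ _ := e.trans (by linarith)

/-- Mirror image: the tag is frozen at the left end `c` and the value at `τ` is corrected. -/
theorem exists_approxPrimitive_left (hh : MonotoneOn h (Icc a b))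
    (hU : ∀ τ ∈ Icc a b, ∀ u ∈ Icc a b, ∀ v ∈ Icc a b, u ≤ v → ‖U τ v - U τ u‖ ≤ h v - h u)
    {ε c τ : ℝ} (hε : 0 < ε) (hc : a ≤ c) (hτ : τ ≤ b) (hcτ : c < τ)
    (hosc : ∀ σ ∈ Ico c τ, ∀ u ∈ Icc a b, ∀ v ∈ Icc a b, u ≤ v →
      ‖(U c v - U c u) - (U σ v - U σ u)‖ ≤ ε * (h v - h u)) :
    ∃ I, ApproxPrimitive U c τ (ε * ((h τ + τ) - (h c + c))) I := by
  have hsub : Icc c τ ⊆ Icc a b := Icc_subset_Icc hc hτ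
  obtain ⟨t₀, ht₀, hsmall⟩ := exists_small_increment_left hh
    (show τ ∈ Ioc a b from ⟨hc.trans_lt hcτ, hτ⟩) (show 0 < ε * (τ - c) / 2 by
      have := mul_pos hε (sub_pos.2 hcτ); linarith)
  have ht₀b : t₀ ∈ Icc a b := ⟨ht₀.1, ht₀.2.le.trans hτ⟩
  have hcτ' : 0 < ε * (τ - c) := mul_pos hε (sub_pos.2 hcτ)
  have hτ' : τ ∈ Icc a b := hsub ⟨hcτ.le, le_rfl⟩
  have hc' : c ∈ Icc a b := hsub ⟨le_rfl, hcτ.le⟩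
  refine ⟨fun t => if t < τ then U c t - U c t₀ else U τ τ - U τ t₀,
    fun t => ε * h t + if t < τ then 0 else ε * (τ - c), ?_, ?_, ?_⟩
  · intro s hs t ht hst
    have h1 := mul_le_mul_of_nonneg_left (hh (hsub hs) (hsub ht) hst) hε.le
    beta_reduce
    split_ifs with h2 h3 h3
    · linarith
    · linarith
    · exact absurd (hst.trans_lt h3) h2
    · linarith
  · simp only [hcτ, if_true, lt_irrefl, if_false]
    exact le_of_eq (by ring)
  · intro σ hσ
    rcases hσ.2.eq_or_lt with rfl | hlt
    · refine ⟨σ - t₀, sub_pos.2 ht₀.2, fun u hu v hv h1 h2 h3 h4 => ?_⟩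
      obtain rfl : v = σ := le_antisymm hv.2 h2
      simp only [lt_irrefl, if_false]
      rcases h1.eq_or_lt with rfl | h1
      · simp
      · simp only [h1, if_true]
        have hut : t₀ ≤ u := by linarith
        have e1 := hU c hc' t₀ ht₀b u (hsub hu) hut
        have e2 := hU v hτ' t₀ ht₀b u (hsub hu) hut
        have e3 := hsmall t₀ ⟨le_rfl, ht₀.2⟩ u ⟨hut, h1⟩
        have e4 := mul_le_mul_of_nonneg_left (hh (hsub hu) hτ' h1.le) hε.le
        calc _ = ‖(U v u - U v t₀) - (U c u - U c t₀)‖ := by congr 1; abel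
          _ ≤ _ := (norm_sub_le _ _).trans (by linarith)
    · refine ⟨τ - σ, sub_pos.2 hlt, fun u hu v hv h1 h2 h3 h4 => ?_⟩
      have hu' : u < τ := by linarith
      have hv' : v < τ := by linarith
      simp only [hu', hv', if_true]
      have e := hosc σ ⟨hσ.1, hlt⟩ u (hsub hu) v (hsub hv) (h1.trans h2)
      calc _ = ‖(U c v - U c u) - (U σ v - U σ u)‖ := by congr 1; abel
        _ ≤ _ := e.trans (by linarith)

/-- A function `U` has approximate primitives if its increments in the second variable are
dominated by those of a nondecreasing function `h` and depend, relative to `h`, uniformly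
continuously on a regulated function of the first variable. -/
theorem exists_approxPrimitive {Y : Type*} [NormedAddCommGroup Y] {y : ℝ → Y} (hab : a ≤ b)
    (hh : MonotoneOn h (Icc a b)) (hy : IsRegulated y a b)
    (hU : ∀ τ ∈ Icc a b, ∀ u ∈ Icc a b, ∀ v ∈ Icc a b, u ≤ v → ‖U τ v - U τ u‖ ≤ h v - h u)
    (hUy : ∀ ε > 0, ∃ η > 0, ∀ σ ∈ Icc a b, ∀ σ' ∈ Icc a b, ‖y σ - y σ'‖ < η →
      ∀ u ∈ Icc a b, ∀ v ∈ Icc a b, u ≤ v →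
        ‖(U σ v - U σ u) - (U σ' v - U σ' u)‖ ≤ ε * (h v - h u))
    {ε : ℝ} (hε : 0 < ε) : ∃ I, ApproxPrimitive U a b ε I := by
  -- Degenerate intervals are treated apart, since the one-sided constructions need a strict
  -- inequality.
  have trivial_case : ∀ τ, ∃ I, ApproxPrimitive U τ τ 0 I := by
    refine fun τ => ⟨fun _ => 0, fun _ => 0, monotoneOn_const, by simp, fun σ _ =>
      ⟨1, one_pos, fun u hu v hv _ _ _ _ => ?_⟩⟩
    obtain rfl : u = τ := le_antisymm hu.2 hu.1
    obtain rfl : v = u := le_antisymm hv.2 hv.1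
    simp
  have key : ∀ ε > 0, ∃ I, ApproxPrimitive U a b (ε * ((h b + b) - (h a + a))) I := by
    intro ε hε
    obtain ⟨η, hη, H⟩ := hUy ε hε
    refine interval_induction hab
      (fun c d => ∃ I, ApproxPrimitive U c d (ε * ((h d + d) - (h c + c))) I) ?_ ?_ ?_
    · rintro c m d - hcm hmd - ⟨I₁, h₁⟩ ⟨I₂, h₂⟩
      exact ⟨_, (h₁.glue hcm hmd h₂).mono (le_of_eq (by ring))⟩
    · intro τ hτ
      rcases hτ.1.eq_or_lt with rfl | hlt
      · refine ⟨1, one_pos, fun c hc h1 _ => ?_⟩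
        obtain rfl : c = a := le_antisymm h1 hc.1
        simpa using trivial_case c
      · obtain ⟨θ, hθ, hosc⟩ := hy.exists_osc_left ⟨hlt, hτ.2⟩ hη
        refine ⟨θ, hθ, fun c hc h1 h2 => ?_⟩
        rcases h1.eq_or_lt with rfl | h1
        · simpa using trivial_case c
        · exact exists_approxPrimitive_left hh hU hε hc.1 hτ.2 h1 fun σ hσ =>
            H c hc σ ⟨hc.1.trans hσ.1, hσ.2.le.trans hτ.2⟩
              (hosc c ⟨h2, h1⟩ σ ⟨h2.trans_le hσ.1, hσ.2⟩)
    · intro τ hτ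
      rcases hτ.2.eq_or_lt with rfl | hlt
      · refine ⟨1, one_pos, fun d hd h1 _ => ?_⟩
        obtain rfl : d = τ := le_antisymm hd.2 h1
        simpa using trivial_case d
      · obtain ⟨θ, hθ, hosc⟩ := hy.exists_osc_right ⟨hτ.1, hlt⟩ hη
        refine ⟨θ, hθ, fun d hd h1 h2 => ?_⟩
        rcases h1.eq_or_lt with rfl | h1
        · simpa using trivial_case τ
        · exact exists_approxPrimitive_right hh hU hε hτ.1 hd.2 h1 fun σ hσ =>
            H d hd σ ⟨hτ.1.trans hσ.1.le, hσ.2.trans hd.2⟩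
              (hosc d ⟨h1, h2⟩ σ ⟨hσ.1, hσ.2.trans_lt h2⟩)
  set k := (h b + b) - (h a + a) with hk
  have hk0 : 0 ≤ k := by
    have := hh ⟨le_rfl, hab⟩ ⟨hab, le_rfl⟩ hab
    linarith
  obtain ⟨I, hI⟩ := key (ε / (k + 1)) (by positivity)
  refine ⟨I, hI.mono ?_⟩
  rw [div_mul_eq_mul_div, div_le_iff₀ (by positivity)]
  nlinarith

/-- Existence of the indefinite Kurzweil integral. -/
theorem exists_isIndefiniteIntegral [CompleteSpace X] {Y : Type*} [NormedAddCommGroup Y]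
    {y : ℝ → Y} (hab : a ≤ b) (hh : MonotoneOn h (Icc a b)) (hy : IsRegulated y a b)
    (hU : ∀ τ ∈ Icc a b, ∀ u ∈ Icc a b, ∀ v ∈ Icc a b, u ≤ v → ‖U τ v - U τ u‖ ≤ h v - h u)
    (hUy : ∀ ε > 0, ∃ η > 0, ∀ σ ∈ Icc a b, ∀ σ' ∈ Icc a b, ‖y σ - y σ'‖ < η →
      ∀ u ∈ Icc a b, ∀ v ∈ Icc a b, u ≤ v →
        ‖(U σ v - U σ u) - (U σ' v - U σ' u)‖ ≤ ε * (h v - h u)) :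
    ∃ J, IsIndefiniteIntegral U a b J := by
  have hI : ∀ m : ℕ, ∃ I, ApproxPrimitive U a b (1 / ((m : ℝ) + 1)) I := fun m =>
    exists_approxPrimitive hab hh hy hU hUy (by positivity)
  choose I hI using hI
  have hlim : Tendsto (fun m : ℕ => 1 / ((m : ℝ) + 1)) atTop (𝓝 0) :=
    tendsto_one_div_add_atTop_nhds_zero_nat
  have hdiff : ∀ s ∈ Icc a b, ∀ m p : ℕ, ‖(I m s - I m a) - (I p s - I p a)‖ ≤
      1 / ((m : ℝ) + 1) + 1 / ((p : ℝ) + 1) := by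
    intro s hs m p
    -- The difference of two approximate primitives of `U` is an approximate primitive of zero, so
    -- `k = 0` is allowed and only the errors remain; this gives the Cauchy property.
    have := ((hI m).sub (hI p)).norm_sub_le (k := fun _ => 0) (by simp) ⟨le_rfl, hab⟩ hs hs.1
    calc _ = ‖(I m s - I p s) - (I m a - I p a)‖ := by congr 1; abel
      _ ≤ _ := by simpa using this
  have hJ : ∀ s, ∃ J, s ∈ Icc a b → Tendsto (fun m => I m s - I m a) atTop (𝓝 J) := by
    intro s
    by_cases hs : s ∈ Icc a b
    · have hc : CauchySeq fun m => I m s - I m a := by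
        refine cauchySeq_of_le_tendsto_0 (fun N : ℕ => 1 / ((N : ℝ) + 1) + 1 / ((N : ℝ) + 1))
          (fun m p N hm hp => ?_) (by simpa using hlim.add hlim)
        rw [dist_eq_norm]
        refine (hdiff s hs m p).trans (add_le_add ?_ ?_)
        · exact Nat.one_div_le_one_div hm
        · exact Nat.one_div_le_one_div hp
      obtain ⟨J, hJ⟩ := cauchySeq_tendsto_of_complete hc
      exact ⟨J, fun _ => hJ⟩
    · exact ⟨0, fun h => absurd h hs⟩
  choose J hJ using hJ
  refine ⟨J, fun ε hε => ?_⟩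
  obtain ⟨m, hm⟩ := exists_nat_one_div_lt hε
  refine ⟨I m, (hI m).mono hm.le, fun s hs => ?_⟩
  have h1 : Tendsto (fun p => ‖(I m s - I m a) - (I p s - I p a)‖) atTop
      (𝓝 ‖I m s - I m a - J s‖) := (tendsto_const_nhds.sub (hJ s hs)).norm
  have h2 : Tendsto (fun p : ℕ => 1 / ((m : ℝ) + 1) + 1 / ((p : ℝ) + 1)) atTop
      (𝓝 (1 / ((m : ℝ) + 1) + 0)) := tendsto_const_nhds.add hlim
  have := le_of_tendsto_of_tendsto' h1 h2 (hdiff s hs m)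
  linarith

end

/-! ### Evaluation of regulated functions -/

section

variable {n : ℕ} {T : ℝ}

theorem ev_of_mem (x : G n T) {t : ℝ} (ht : t ∈ Icc 0 T) : ev x t = (x : Bdd n T) ⟨t, ht⟩ := by
  simp only [ev, ext0, dif_pos ht]

theorem ev_of_notMem (x : G n T) {t : ℝ} (ht : t ∉ Icc 0 T) : ev x t = 0 := by
  simp only [ev, ext0, dif_neg ht]

theorem ev_add (x y : G n T) (t : ℝ) : ev (x + y) t = ev x t + ev y t := by
  by_cases ht : t ∈ Icc 0 T
  · simp [ev_of_mem _ ht]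
  · simp [ev_of_notMem _ ht]

theorem ev_sub (x y : G n T) (t : ℝ) : ev (x - y) t = ev x t - ev y t := by
  by_cases ht : t ∈ Icc 0 T
  · simp [ev_of_mem _ ht]
  · simp [ev_of_notMem _ ht]

theorem ev_smul (c : ℝ) (x : G n T) (t : ℝ) : ev (c • x) t = c • ev x t := by
  by_cases ht : t ∈ Icc 0 T
  · simp [ev_of_mem _ ht]
  · simp [ev_of_notMem _ ht]

theorem ev_mkG (f : ℝ → E n) (hf : IsRegulated f 0 T) {t : ℝ} (ht : t ∈ Icc 0 T) :
    ev (mkG f hf) t = f t := by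
  rw [ev_of_mem _ ht]
  rfl

theorem ev_ext {x y : G n T} (h : ∀ t ∈ Icc 0 T, ev x t = ev y t) : x = y := by
  refine Subtype.ext (lp.ext (funext fun t => ?_))
  have := h t t.2
  rwa [ev_of_mem _ t.2, ev_of_mem _ t.2] at this

theorem isRegulated_ev (x : G n T) : IsRegulated (ev x) 0 T := x.2

theorem norm_ev_le (x : G n T) (t : ℝ) : ‖ev x t‖ ≤ ‖x‖ := by
  by_cases ht : t ∈ Icc 0 T
  · rw [ev_of_mem _ ht]
    exact lp.norm_apply_le_norm ENNReal.top_ne_zero (x : Bdd n T) ⟨t, ht⟩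
  · simp [ev_of_notMem _ ht]

theorem norm_le_of_ev {x : G n T} {C : ℝ} (hC : 0 ≤ C) (h : ∀ t ∈ Icc 0 T, ‖ev x t‖ ≤ C) :
    ‖x‖ ≤ C := by
  refine lp.norm_le_of_forall_le (f := (x : Bdd n T)) hC fun t => ?_
  rw [← ev_of_mem x t.2]
  exact h t t.2

end

/-! ### Jacobian matrices and operators -/

/-- The matrix norm takes row sums, whereas the operator norm for `∑ |xᵢ|` is governed by column
sums. Each entry is at most `‖M‖`, and summing over the `n` rows costs the factor `n`. -/
theorem norm_le_card_mul_norm_toMatrix {n : ℕ} (L : E n →L[ℝ] E n) :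
    ‖L‖ ≤ n * ‖LinearMap.toMatrix (PiLp.basisFun 1 ℝ (Fin n)) (PiLp.basisFun 1 ℝ (Fin n))
      L.toLinearMap‖ := by
  set M := LinearMap.toMatrix (PiLp.basisFun 1 ℝ (Fin n)) (PiLp.basisFun 1 ℝ (Fin n))
      L.toLinearMap with hM
  have hentry : ∀ i j, |M i j| ≤ ‖M‖ := by
    intro i j
    have h1 : ‖M i j‖₊ ≤ Finset.univ.sup fun i => ∑ j, ‖M i j‖₊ :=
      (Finset.single_le_sum (f := fun j => ‖M i j‖₊) (fun _ _ => zero_le) (Finset.mem_univ j)).trans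
        (Finset.le_sup (f := fun i => ∑ j, ‖M i j‖₊) (Finset.mem_univ i))
    rw [Matrix.linfty_opNorm_def]
    exact_mod_cast h1
  refine L.opNorm_le_bound (by positivity) fun v => ?_
  have happ : ∀ i, (L v) i = ∑ j, M i j * v j := by
    intro i
    have := congrFun (LinearMap.toMatrix_mulVec_repr (PiLp.basisFun 1 ℝ (Fin n))
      (PiLp.basisFun 1 ℝ (Fin n)) L.toLinearMap v) i
    simpa [Matrix.mulVec, dotProduct, hM] using this.symm
  have hnorm : ∀ w : E n, ‖w‖ = ∑ i, |w i| := by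
    intro w
    simp [PiLp.norm_eq_of_L1]
  calc ‖L v‖ = ∑ i, |(L v) i| := hnorm _
    _ ≤ ∑ _i : Fin n, ‖M‖ * ‖v‖ := by
        refine Finset.sum_le_sum fun i _ => ?_
        rw [happ, hnorm v, Finset.mul_sum]
        refine (Finset.abs_sum_le_sum_abs _ _).trans (Finset.sum_le_sum fun j _ => ?_)
        rw [abs_mul]
        exact mul_le_mul_of_nonneg_right (hentry i j) (abs_nonneg _)
    _ = n * ‖M‖ * ‖v‖ := by simp [mul_assoc]

/-- The four-term shape is that of the second differences in the hypotheses; zeros in the last two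
places give plain increments. -/
theorem norm_combination_le_jacobian {n : ℕ} (L₁ L₂ L₃ L₄ : E n →L[ℝ] E n) :
    ‖L₁ - L₂ - L₃ + L₄‖ ≤ n *
      ‖LinearMap.toMatrix (PiLp.basisFun 1 ℝ (Fin n)) (PiLp.basisFun 1 ℝ (Fin n)) L₁.toLinearMap
      - LinearMap.toMatrix (PiLp.basisFun 1 ℝ (Fin n)) (PiLp.basisFun 1 ℝ (Fin n)) L₂.toLinearMap
      - LinearMap.toMatrix (PiLp.basisFun 1 ℝ (Fin n)) (PiLp.basisFun 1 ℝ (Fin n)) L₃.toLinearMap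
      + LinearMap.toMatrix (PiLp.basisFun 1 ℝ (Fin n)) (PiLp.basisFun 1 ℝ (Fin n))
        L₄.toLinearMap‖ := by
  refine (norm_le_card_mul_norm_toMatrix _).trans (le_of_eq ?_)
  rw [ContinuousLinearMap.toLinearMap_add, ContinuousLinearMap.toLinearMap_sub,
    ContinuousLinearMap.toLinearMap_sub, map_add, map_sub, map_sub]

/-- The factor `n` is absorbed into `h`, leaving `ω` unchanged. -/
theorem ClassF.fderiv_of_jacobian {n : ℕ} {T : ℝ} {Ω : Set (E n)} {h ω : ℝ → ℝ}
    {F : ℝ → E n → ℝ → E n} {lam : ℝ} (hF : ClassF Ω T h ω (jacobian F lam)) :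
    ClassF Ω T (fun t => n * h t) ω (fun x t => fderiv ℝ (fun y => F lam y t) x) := by
  refine ⟨fun x hx t₁ ht₁ t₂ ht₂ => ?_, fun x hx y hy t₁ ht₁ t₂ ht₂ => ?_⟩
  · have h1 := norm_combination_le_jacobian (fderiv ℝ (fun y => F lam y t₂) x)
      (fderiv ℝ (fun y => F lam y t₁) x) 0 0
    have h2 := hF.1 x hx t₁ ht₁ t₂ ht₂
    simp only [ContinuousLinearMap.toLinearMap_zero, map_zero, sub_zero, add_zero] at h1
    rw [← mul_sub, abs_mul, Nat.abs_cast]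
    exact h1.trans (mul_le_mul_of_nonneg_left h2 n.cast_nonneg)
  · have h1 := norm_combination_le_jacobian (fderiv ℝ (fun y => F lam y t₂) x)
      (fderiv ℝ (fun y => F lam y t₁) x) (fderiv ℝ (fun y => F lam y t₂) y)
      (fderiv ℝ (fun y => F lam y t₁) y)
    have h2 := hF.2 x hx y hy t₁ ht₁ t₂ ht₂
    rw [← mul_sub, abs_mul, Nat.abs_cast]
    exact h1.trans ((mul_le_mul_of_nonneg_left h2 n.cast_nonneg).trans (le_of_eq (by ring)))

theorem UniformInParameter.fderiv_of_jacobian {n : ℕ} {T : ℝ} {Λ : Set ℝ} {Ω : Set (E n)}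
    {F : ℝ → E n → ℝ → E n} (hF : UniformInParameter Λ Ω T (jacobian F)) :
    UniformInParameter Λ Ω T (fun lam x t => fderiv ℝ (fun y => F lam y t) x) := by
  obtain ⟨γ, hγ, H⟩ := hF
  refine ⟨fun t => n * γ t,
    fun s hs t ht hst => mul_le_mul_of_nonneg_left (hγ hs ht hst) n.cast_nonneg,
    fun ε hε => ?_⟩
  obtain ⟨δ, hδ, k⟩ := H ε hε
  refine ⟨δ, hδ, fun x hx t ht s hs l₁ hl₁ l₂ hl₂ hl => ?_⟩
  have h1 := norm_combination_le_jacobian (fderiv ℝ (fun y => F l₁ y t) x)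
    (fderiv ℝ (fun y => F l₂ y t) x) (fderiv ℝ (fun y => F l₁ y s) x)
    (fderiv ℝ (fun y => F l₂ y s) x)
  rw [← mul_sub, abs_mul, Nat.abs_cast]
  exact h1.trans ((mul_le_mul_of_nonneg_left (k x hx t ht s hs l₁ hl₁ l₂ hl₂ hl)
    n.cast_nonneg).trans (le_of_eq (by ring)))

/-! ### Integrals along regulated functions -/

theorem IsModulus.exists_le {ω : ℝ → ℝ} (hω : IsModulus ω) {ε : ℝ} (hε : 0 < ε) :
    ∃ η > 0, ∀ r, 0 ≤ r → r < η → ω r ≤ ε := by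
  have h0 : ContinuousWithinAt ω (Ici 0) 0 := hω.2.1 0 self_mem_Ici
  obtain ⟨η, hη, h⟩ := Metric.continuousWithinAt_iff.1 h0 ε hε
  refine ⟨η, hη, fun r hr hrη => ?_⟩
  have := h hr (by simpa [abs_of_nonneg hr] using hrη)
  rw [hω.2.2, Real.dist_eq, sub_zero] at this
  exact (le_abs_self _).trans this.le

section

variable {n : ℕ} {T : ℝ} {Ω : Set (E n)} {h ω : ℝ → ℝ}

theorem ClassF.norm_sub_le {X : Type*} [NormedAddCommGroup X] {f : E n → ℝ → X}
    (hf : ClassF Ω T h ω f) (hh : MonotoneOn h (Icc 0 T)) {x : E n} (hx : x ∈ Ω) {u v : ℝ}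
    (hu : u ∈ Icc 0 T) (hv : v ∈ Icc 0 T) (huv : u ≤ v) : ‖f x v - f x u‖ ≤ h v - h u := by
  have := hf.1 x hx u hu v hv
  rwa [abs_of_nonneg (sub_nonneg.2 (hh hu hv huv))] at this

theorem ClassF.norm_sub_sub_le {X : Type*} [NormedAddCommGroup X] {f : E n → ℝ → X}
    (hf : ClassF Ω T h ω f) (hh : MonotoneOn h (Icc 0 T)) {x y : E n} (hx : x ∈ Ω) (hy : y ∈ Ω)
    {u v : ℝ} (hu : u ∈ Icc 0 T) (hv : v ∈ Icc 0 T) (huv : u ≤ v) :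
    ‖(f x v - f x u) - (f y v - f y u)‖ ≤ ω ‖x - y‖ * (h v - h u) := by
  have := hf.2 x hx y hy u hu v hv
  rw [abs_of_nonneg (sub_nonneg.2 (hh hu hv huv))] at this
  rwa [← sub_add]

theorem ClassF.exists_isIndefiniteIntegral {X : Type*} [NormedAddCommGroup X] [CompleteSpace X]
    {f : E n → ℝ → X} (hT : 0 ≤ T) (hf : ClassF Ω T h ω f) (hh : MonotoneOn h (Icc 0 T))
    (hω : IsModulus ω) {x : G n T} (hx : ∀ t ∈ Icc 0 T, ev x t ∈ Ω) :
    ∃ J, IsIndefiniteIntegral (fun τ t => f (ev x τ) t) 0 T J := by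
  refine GenODE.exists_isIndefiniteIntegral hT hh (isRegulated_ev x)
    (fun τ hτ u hu v hv huv => hf.norm_sub_le hh (hx τ hτ) hu hv huv) fun ε hε => ?_
  obtain ⟨η, hη, H⟩ := hω.exists_le hε
  refine ⟨η, hη, fun σ hσ σ' hσ' hlt u hu v hv huv =>
    (hf.norm_sub_sub_le hh (hx σ hσ) (hx σ' hσ') hu hv huv).trans ?_⟩
  exact mul_le_mul_of_nonneg_right (H _ (norm_nonneg _) hlt) (sub_nonneg.2 (hh hu hv huv))

/-- The integrand depends on the tag through both `x` and `z`, so the existence theorem is applied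
to the regulated pair `(x, z)`. -/
theorem ClassF.exists_isIndefiniteIntegral_apply {D : E n → ℝ → E n →L[ℝ] E n} (hT : 0 ≤ T)
    (hD : ClassF Ω T h ω D) (hh : MonotoneOn h (Icc 0 T)) (hω : IsModulus ω) {x : G n T}
    (hx : ∀ t ∈ Icc 0 T, ev x t ∈ Ω) (z : G n T) :
    ∃ K, IsIndefiniteIntegral (fun τ t => D (ev x τ) t (ev z τ)) 0 T K := by
  have hinc : ∀ u ∈ Icc 0 T, ∀ v ∈ Icc 0 T, u ≤ v → 0 ≤ h v - h u := fun u hu v hv huv =>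
    sub_nonneg.2 (hh hu hv huv)
  have hz : 0 ≤ ‖z‖ := norm_nonneg z
  refine GenODE.exists_isIndefiniteIntegral (h := fun t => (‖z‖ + 1) * h t) hT
    (fun s hs t ht hst => mul_le_mul_of_nonneg_left (hh hs ht hst) (by positivity))
    ((isRegulated_ev x).prodMk (isRegulated_ev z)) (fun τ hτ u hu v hv huv => ?_)
    fun ε hε => ?_
  · rw [← _root_.sub_apply]
    have h1 := (D (ev x τ) v - D (ev x τ) u).le_of_opNorm_le_of_le
      (hD.norm_sub_le hh (hx τ hτ) hu hv huv) (norm_ev_le z τ)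
    have h2 := hinc u hu v hv huv
    refine h1.trans ?_
    rw [← mul_sub]
    nlinarith
  · obtain ⟨η, hη, H⟩ := hω.exists_le hε
    -- Changing `D` costs `ε * ‖z‖` through `ω`, and changing `z` costs a further `ε`; this is why
    -- the dominating function is `(‖z‖ + 1) * h`.
    refine ⟨min η ε, lt_min hη hε, fun σ hσ σ' hσ' hlt u hu v hv huv => ?_⟩
    rw [Prod.mk_sub_mk, Prod.norm_mk, max_lt_iff] at hlt
    have h0 := hinc u hu v hv huv
    have h1 := ((D (ev x σ) v - D (ev x σ) u) -
      (D (ev x σ') v - D (ev x σ') u)).le_of_opNorm_le_of_le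
      ((hD.norm_sub_sub_le hh (hx σ hσ) (hx σ' hσ') hu hv huv).trans
        (mul_le_mul_of_nonneg_right (H _ (norm_nonneg _) (hlt.1.trans_le (min_le_left _ _))) h0))
      (norm_ev_le z σ)
    have h2 := (D (ev x σ') v - D (ev x σ') u).le_of_opNorm_le_of_le
      (hD.norm_sub_le hh (hx σ' hσ') hu hv huv) (hlt.2.le.trans (min_le_right _ _))
    calc _ = ‖((D (ev x σ) v - D (ev x σ) u) - (D (ev x σ') v - D (ev x σ') u)) (ev z σ)
          + (D (ev x σ') v - D (ev x σ') u) (ev z σ - ev z σ')‖ := by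
          congr 1
          simp only [_root_.sub_apply, map_sub]
          abel
      _ ≤ _ := (norm_add_le _ _).trans (add_le_add h1 h2)
      _ = _ := by ring

/-- The bounded linear operator `z ↦ z(T) + ∫_0^s D[D(x(τ), t) z(τ)]` on `G[0, T]`. -/
theorem ClassF.exists_linearization {D : E n → ℝ → E n →L[ℝ] E n} (hT : 0 ≤ T)
    (hD : ClassF Ω T h ω D) (hh : MonotoneOn h (Icc 0 T)) (hω : IsModulus ω) {x : G n T}
    (hx : ∀ t ∈ Icc 0 T, ev x t ∈ Ω) :
    ∃ A : G n T →L[ℝ] G n T, ∀ z, ∃ K,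
      IsIndefiniteIntegral (fun τ t => D (ev x τ) t (ev z τ)) 0 T K ∧
      ∀ s ∈ Icc 0 T, ev (A z) s = ev z T + K s := by
  choose K hK using fun z => hD.exists_isIndefiniteIntegral_apply hT hh hω hx z
  have hbound : ∀ z, ∀ s ∈ Icc 0 T, ∀ t ∈ Icc 0 T, s ≤ t →
      ‖K z t - K z s‖ ≤ ‖z‖ * h t - ‖z‖ * h s := by
    intro z s hs t ht hst
    refine (hK z).norm_sub_le (k := fun t => ‖z‖ * h t) (fun τ hτ u hu v hv h1 h2 => ?_) hs ht hst
    rw [← _root_.sub_apply, ← mul_sub, mul_comm]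
    exact (D (ev x τ) v - D (ev x τ) u).le_of_opNorm_le_of_le
      (hD.norm_sub_le hh (hx τ hτ) hu hv (h1.trans h2)) (norm_ev_le z τ)
  have hreg : ∀ z, IsRegulated (fun s => ev z T + K z s) 0 T := fun z =>
    isRegulated_of_norm_sub_le (k := fun t => ‖z‖ * h t)
      (fun s hs t ht hst => mul_le_mul_of_nonneg_left (hh hs ht hst) (norm_nonneg z))
      fun s hs t ht hst => by simpa using hbound z s hs t ht hst
  -- Each `K z` was merely chosen, so linearity in `z` is recovered from uniqueness of the integral.
  have hunique : ∀ z J, IsIndefiniteIntegral (fun τ t => D (ev x τ) t (ev z τ)) 0 T J →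
      ∀ s ∈ Icc 0 T, K z s = J s := fun z J hJ s hs => by
    rw [← (hK z).kurzweilIntegral_eq hs, hJ.kurzweilIntegral_eq hs]
  have h0T : (0 : ℝ) ∈ Icc 0 T := ⟨le_rfl, hT⟩
  let A : G n T →ₗ[ℝ] G n T :=
    { toFun := fun z => mkG (fun s => ev z T + K z s) (hreg z)
      map_add' := fun z w => ev_ext fun s hs => by
        have := hunique (z + w) _ (((hK z).add (hK w)).congr fun τ _ t _ => by
          rw [ev_add, map_add]) s hs
        refine (ev_mkG _ _ hs).trans ?_
        rw [ev_add (mkG _ _), ev_mkG _ _ hs, ev_mkG _ _ hs, this, ev_add]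
        abel
      map_smul' := fun c z => ev_ext fun s hs => by
        have := hunique (c • z) _ (((hK z).const_smul c).congr fun τ _ t _ => by
          rw [ev_smul, map_smul]) s hs
        refine (ev_mkG _ _ hs).trans ?_
        rw [RingHom.id_apply, ev_smul c (mkG _ _), ev_mkG _ _ hs, this, ev_smul, smul_add] }
  refine ⟨A.mkContinuous (1 + (h T - h 0)) fun z => ?_, fun z =>
    ⟨K z, hK z, fun s hs => ev_mkG _ (hreg z) hs⟩⟩
  have hinc : 0 ≤ h T - h 0 := sub_nonneg.2 (hh h0T ⟨hT, le_rfl⟩ hT)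
  refine norm_le_of_ev (by positivity) fun s hs => ?_
  have h1 : ev (A z) s = ev z T + K z s := ev_mkG _ (hreg z) hs
  have h2 := hbound z 0 h0T s hs hs.1
  rw [(hK z).apply_left hT, sub_zero] at h2
  have h3 := mul_le_mul_of_nonneg_left (hh hs ⟨hT, le_rfl⟩ hs.2) (norm_nonneg z)
  rw [h1]
  refine (norm_add_le _ _).trans ?_
  linarith [norm_ev_le z T]

/-- `Φ(lam, x)` is given by the integral formula. -/
theorem ClassF.exists_integral_Phi {F : ℝ → E n → ℝ → E n} {lam : ℝ} (hT : 0 ≤ T)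
    (hF : ClassF Ω T h ω (F lam)) (hh : MonotoneOn h (Icc 0 T)) (hω : IsModulus ω) {x : G n T}
    (hx : ∀ t ∈ Icc 0 T, ev x t ∈ Ω) :
    ∃ J, IsIndefiniteIntegral (fun τ t => F lam (ev x τ) t) 0 T J ∧
      ∀ s ∈ Icc 0 T, ev (Phi F lam x) s = ev x T + J s := by
  obtain ⟨J, hJ⟩ := hF.exists_isIndefiniteIntegral hT hh hω hx
  have hfun : ∀ s ∈ Icc 0 T, PhiFun F lam x s = ev x T + J s := fun s hs => by
    rw [PhiFun, hJ.kurzweilIntegral_eq hs]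
  have hreg : IsRegulated (PhiFun F lam x) 0 T := by
    refine isRegulated_of_norm_sub_le hh fun s hs t ht hst => ?_
    rw [hfun s hs, hfun t ht, add_sub_add_left_eq_sub]
    exact hJ.norm_sub_le (fun τ hτ u hu v hv h1 h2 =>
      hF.norm_sub_le hh (hx τ hτ) hu hv (h1.trans h2)) hs ht hst
  refine ⟨J, hJ, fun s hs => ?_⟩
  rw [Phi, dif_pos hreg, ev_mkG _ _ hs, hfun s hs]

end

/-! ### Linearization of the operator -/

/-- For `x` in the ball and `lam` near `lam₀`, the operator `Φ(lam, ·)` is close to its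
linearization at `(lam₀, x₀)`. -/
theorem norm_Phi_sub_Phi_sub_le {n : ℕ} {T : ℝ} (hT : 0 ≤ T) {Λ : Set ℝ} {Ω : Set (E n)}
    {F : ℝ → E n → ℝ → E n} {x₀ : G n T} {ρ : ℝ} (hB1 : CondB1 T Λ Ω F)
    (hρ : 0 < ρ) (hball : ∀ t ∈ Icc 0 T, ∀ x ∈ Metric.closedBall x₀ ρ, ev x t ∈ Ω)
    (hC1 : CondC1 T Λ Ω F) (hC3 : CondC3 T Λ Ω F) {lam₀ : ℝ} (hlam₀ : lam₀ ∈ Λ) :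
    ∃ A : G n T →L[ℝ] G n T, ∀ ε > 0, ∃ δ > 0, ∀ x ∈ Metric.closedBall x₀ ρ, ∀ lam ∈ Λ,
      ‖x - x₀‖ < δ → |lam - lam₀| < δ →
        ‖Phi F lam x - Phi F lam x₀ - A (x - x₀)‖ ≤ ε * ‖x - x₀‖ := by
  obtain ⟨-, -, h, ω, hh, hω, hF⟩ := hB1
  obtain ⟨hdiff, -, h', ω', hh', -, hω', hF'⟩ := hC1
  obtain ⟨γ, hγ, hpar⟩ := UniformInParameter.fderiv_of_jacobian hC3
  set k : ℝ → ℝ := fun t => n * h' t with hk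
  have hkmono : MonotoneOn k (Icc 0 T) := fun s hs t ht hst =>
    mul_le_mul_of_nonneg_left (hh' hs ht hst) n.cast_nonneg
  set D : ℝ → E n → ℝ → E n →L[ℝ] E n := fun lam x t => fderiv ℝ (fun y => F lam y t) x with hDdef
  have hD : ∀ lam ∈ Λ, ClassF Ω T k ω' (D lam) := fun lam hlam => (hF' lam hlam).fderiv_of_jacobian
  have hx₀ : x₀ ∈ Metric.closedBall x₀ ρ := Metric.mem_closedBall_self hρ.le
  obtain ⟨A, hA⟩ := (hD lam₀ hlam₀).exists_linearization hT hkmono hω'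
    fun t ht => hball t ht x₀ hx₀
  refine ⟨A, fun ε hε => ?_⟩
  have h0T : (0 : ℝ) ∈ Icc 0 T := ⟨le_rfl, hT⟩
  have hTT : T ∈ Icc 0 T := ⟨hT, le_rfl⟩
  -- The total increment of `k + γ`, plus `1` to make it positive; the integrand is bounded with `κ
  -- = ε / C`, so integration gives back `ε`.
  set C : ℝ := (k T - k 0) + (γ T - γ 0) + 1 with hC
  have hk0 : 0 ≤ k T - k 0 := sub_nonneg.2 (hkmono h0T hTT hT)
  have hγ0 : 0 ≤ γ T - γ 0 := sub_nonneg.2 (hγ h0T hTT hT)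
  have hCpos : 0 < C := by linarith
  set κ : ℝ := ε / C with hκ
  have hκpos : 0 < κ := by positivity
  have hκC : κ * C = ε := div_mul_cancel₀ _ hCpos.ne'
  obtain ⟨δ₁, hδ₁, H₁⟩ := hω'.exists_le hκpos
  obtain ⟨δ₂, hδ₂, H₂⟩ := hpar κ hκpos
  refine ⟨min δ₁ δ₂, lt_min hδ₁ hδ₂, fun x hx lam hlam hxδ hlamδ => ?_⟩
  obtain ⟨J, hJ, hPhi⟩ := (hF lam hlam).exists_integral_Phi hT hh hω fun t ht => hball t ht x hx
  obtain ⟨J₀, hJ₀, hPhi₀⟩ := (hF lam hlam).exists_integral_Phi hT hh hω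
    fun t ht => hball t ht x₀ hx₀
  obtain ⟨K, hK, hAK⟩ := hA (x - x₀)
  have hint := (hJ.sub hJ₀).sub hK
  have hinc : ∀ τ ∈ Icc 0 T, ∀ u ∈ Icc 0 T, ∀ v ∈ Icc 0 T, u ≤ τ → τ ≤ v →
      ‖(F lam (ev x τ) v - F lam (ev x₀ τ) v - D lam₀ (ev x₀ τ) v (ev (x - x₀) τ)) -
        (F lam (ev x τ) u - F lam (ev x₀ τ) u - D lam₀ (ev x₀ τ) u (ev (x - x₀) τ))‖
      ≤ κ * ‖x - x₀‖ * (k v + γ v) - κ * ‖x - x₀‖ * (k u + γ u) := by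
    intro τ hτ u hu v hv huτ hτv
    have huv := huτ.trans hτv
    have hk1 : 0 ≤ k v - k u := sub_nonneg.2 (hkmono hu hv huv)
    have hγ1 : 0 ≤ γ v - γ u := sub_nonneg.2 (hγ hu hv huv)
    -- `Ω` need not be convex: points of the segment are values of `x₀ + θ • (x - x₀)`, which stays
    -- in the ball.
    have hseg : ∀ y ∈ segment ℝ (ev x₀ τ) (ev x τ), y ∈ Ω ∧ ‖y - ev x₀ τ‖ ≤ ‖x - x₀‖ := by
      intro y hy
      rw [segment_eq_image'] at hy
      obtain ⟨θ, hθ, rfl⟩ := hy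
      constructor
      · have hmem : x₀ + θ • (x - x₀) ∈ Metric.closedBall x₀ ρ := by
          rw [mem_closedBall_iff_norm, add_sub_cancel_left, norm_smul, Real.norm_eq_abs,
            abs_of_nonneg hθ.1]
          exact (mul_le_of_le_one_left (norm_nonneg _) hθ.2).trans (mem_closedBall_iff_norm.1 hx)
        have := hball τ hτ _ hmem
        rwa [ev_add, ev_smul, ev_sub] at this
      · rw [add_sub_cancel_left, ← ev_sub, norm_smul, Real.norm_eq_abs, abs_of_nonneg hθ.1]
        exact (mul_le_of_le_one_left (norm_nonneg _) hθ.2).trans (norm_ev_le _ _)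
    have hder : ∀ y ∈ segment ℝ (ev x₀ τ) (ev x τ),
        HasFDerivWithinAt (fun y => F lam y v - F lam y u) (D lam y v - D lam y u)
          (segment ℝ (ev x₀ τ) (ev x τ)) y := fun y hy =>
      ((hdiff lam hlam y (hseg y hy).1 v hv).hasFDerivAt.sub
        (hdiff lam hlam y (hseg y hy).1 u hu).hasFDerivAt).hasFDerivWithinAt
    have hx₀Ω := hball τ hτ x₀ hx₀
    have hbd : ∀ y ∈ segment ℝ (ev x₀ τ) (ev x τ),
        ‖(D lam y v - D lam y u) - (D lam₀ (ev x₀ τ) v - D lam₀ (ev x₀ τ) u)‖ ≤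
          κ * (k v - k u) + κ * (γ v - γ u) := by
      intro y hy
      obtain ⟨hyΩ, hyn⟩ := hseg y hy
      have e1 := (hD lam hlam).norm_sub_sub_le hkmono hyΩ hx₀Ω hu hv huv
      have e2 := H₂ (ev x₀ τ) hx₀Ω v hv u hu lam hlam lam₀ hlam₀
        (hlamδ.trans_le (min_le_right _ _))
      rw [abs_of_nonneg hγ1] at e2
      have e3 := mul_le_mul_of_nonneg_right (H₁ _ (norm_nonneg (y - ev x₀ τ))
        (hyn.trans_lt (hxδ.trans_le (min_le_left _ _)))) hk1
      -- The point moves from `y` to `x₀(τ)` at fixed `lam`, which costs increments of `k`; then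
      -- `lam` moves to `lam₀`, which costs increments of `γ`.
      calc _ = ‖((D lam y v - D lam y u) - (D lam (ev x₀ τ) v - D lam (ev x₀ τ) u)) +
            (D lam (ev x₀ τ) v - D lam₀ (ev x₀ τ) v - D lam (ev x₀ τ) u
              + D lam₀ (ev x₀ τ) u)‖ := by congr 1; abel
        _ ≤ _ := (norm_add_le _ _).trans (add_le_add (e1.trans e3) e2)
    have hmv := (convex_segment (ev x₀ τ) (ev x τ)).norm_image_sub_le_of_norm_hasFDerivWithin_le'
      hder hbd (left_mem_segment ℝ _ _) (right_mem_segment ℝ _ _)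
    rw [← ev_sub] at hmv
    calc _ = ‖(F lam (ev x τ) v - F lam (ev x τ) u) - (F lam (ev x₀ τ) v - F lam (ev x₀ τ) u)
          - (D lam₀ (ev x₀ τ) v - D lam₀ (ev x₀ τ) u) (ev (x - x₀) τ)‖ := by
          congr 1
          rw [_root_.sub_apply]
          abel
      _ ≤ _ := hmv
      _ ≤ (κ * (k v - k u) + κ * (γ v - γ u)) * ‖x - x₀‖ :=
          mul_le_mul_of_nonneg_left (norm_ev_le _ _) (by positivity)
      _ = _ := by ring
  refine norm_le_of_ev (by positivity) fun s hs => ?_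
  have hb := hint.norm_sub_le (k := fun t => κ * ‖x - x₀‖ * (k t + γ t)) hinc h0T hs hs.1
  rw [hint.apply_left hT, sub_zero] at hb
  have hks := hkmono hs hTT hs.2
  have hγs := hγ hs hTT hs.2
  have hx0 : 0 ≤ κ * ‖x - x₀‖ := by positivity
  calc _ = ‖J s - J₀ s - K s‖ := by
        rw [ev_sub, ev_sub, hPhi s hs, hPhi₀ s hs, hAK s hs, ev_sub]
        congr 1
        abel
    _ ≤ _ := hb
    _ = κ * ‖x - x₀‖ * (k s - k 0 + (γ s - γ 0)) := by ring
    _ ≤ κ * ‖x - x₀‖ * C := mul_le_mul_of_nonneg_left (by linarith) hx0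
    _ = ε * ‖x - x₀‖ := by rw [← hκC]; ring

/-- A solution of the periodic problem is a fixed point of `Φ`. -/
theorem IsPeriodicSolution.eq_Phi {n : ℕ} {T : ℝ} {Ω : Set (E n)} {F : ℝ → E n → ℝ → E n}
    {x : G n T} {lam : ℝ} (hx : IsPeriodicSolution F Ω x lam) : x = Phi F lam x := by
  have hfun : ∀ s ∈ Icc 0 T, ev x s = PhiFun F lam x s := fun s hs => by
    rw [PhiFun, (hx.1 s hs).2.kurzweilIntegral_eq hs.1, hx.2]
    abel
  have hreg : IsRegulated (PhiFun F lam x) 0 T := (isRegulated_ev x).congr hfun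
  refine ev_ext fun s hs => ?_
  rw [Phi, dif_pos hreg, ev_mkG _ _ hs, hfun s hs]

end GenODE

/-! ### Local uniqueness of fixed points and absence of bifurcation -/

theorem mainTheorem2 (n : ℕ) (T : ℝ) (hT : 0 < T)
    (Λ : Set ℝ) (Ω : Set (GenODE.E n))
    (F : ℝ → GenODE.E n → ℝ → GenODE.E n)
    (x₀ : GenODE.G n T) (ρ : ℝ)
    (hB1 : GenODE.CondB1 T Λ Ω F)
    (hB2 : GenODE.CondB2 Λ Ω F x₀ ρ)
    (hB3 : GenODE.CondB3 T Λ Ω F)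
    (hC1 : GenODE.CondC1 T Λ Ω F)
    (hC3 : GenODE.CondC3 T Λ Ω F)
    (lam₀ : ℝ) (hlam₀ : lam₀ ∈ Λ)
    (hiso : (ContinuousLinearMap.id ℝ (GenODE.G n T) -
      fderiv ℝ (GenODE.Phi (T := T) F lam₀) x₀).IsInvertible) :
    ∃ δ > 0, ∀ (x : GenODE.G n T) (lam : ℝ),
      ‖x - x₀‖ + |lam - lam₀| < δ →
        ¬ GenODE.IsBifurcationPoint F Λ x₀ ρ x lam := by
  obtain ⟨hsol, hρ, hball⟩ := hB2
  obtain ⟨A, hA⟩ := GenODE.norm_Phi_sub_Phi_sub_le hT.le hB1 hρ hball hC1 hC3 hlam₀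
  have hderiv : HasFDerivAt (GenODE.Phi (T := T) F lam₀) A x₀ := by
    refine .of_isLittleO (Asymptotics.isLittleO_iff.2 fun ε hε => ?_)
    obtain ⟨δ, hδ, H⟩ := hA ε hε
    -- The radius is also bounded by `ρ` because the estimate holds only inside the ball.
    filter_upwards [Metric.ball_mem_nhds x₀ (lt_min hδ hρ)] with x hx
    rw [mem_ball_iff_norm] at hx
    exact H x (mem_closedBall_iff_norm.2 (hx.trans_le (min_le_right _ _)).le) lam₀ hlam₀
      (hx.trans_le (min_le_left _ _)) (by simpa using hδ)
  rw [hderiv.fderiv] at hiso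
  obtain ⟨e, he⟩ := hiso
  obtain ⟨c, hc, hanti⟩ : ∃ c > 0, ∀ z, ‖z‖ ≤ c * ‖z - A z‖ := by
    -- The bounded inverse gives the lower bound; the added `1` makes `c` positive even if the
    -- inverse has norm zero.
    refine ⟨‖(e.symm : GenODE.G n T →L[ℝ] GenODE.G n T)‖ + 1, by positivity, fun z => ?_⟩
    have h1 : e z = z - A z := congrArg (fun L : GenODE.G n T →L[ℝ] GenODE.G n T => L z) he
    have h2 := (e.symm : GenODE.G n T →L[ℝ] GenODE.G n T).le_opNorm (e z)
    rw [ContinuousLinearEquiv.coe_coe, e.symm_apply_apply] at h2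
    rw [← h1]
    exact h2.trans (mul_le_mul_of_nonneg_right (by linarith) (norm_nonneg _))
  obtain ⟨δ, hδ, H⟩ := hA (1 / (2 * c)) (by positivity)
  have hunique : ∀ x lam, GenODE.SolvesOp F Λ x₀ ρ x lam → ‖x - x₀‖ < δ → |lam - lam₀| < δ →
      x = x₀ := by
    rintro x lam ⟨hx, hlam, hfix⟩ h1 h2
    have h3 := H x hx lam hlam h1 h2
    -- Both values of `Φ` reduce to their arguments, `x₀` being a fixed point for this same `lam`.
    rw [← hfix, ← (hsol lam hlam).eq_Phi] at h3
    have h4 := (hanti (x - x₀)).trans (mul_le_mul_of_nonneg_left h3 hc.le)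
    rw [← mul_assoc, show c * (1 / (2 * c)) = 1 / 2 by field_simp] at h4
    rw [← sub_eq_zero, ← norm_le_zero_iff]
    linarith
  refine ⟨δ, hδ, fun x lam hlt hbif => ?_⟩
  -- A bifurcation point is itself a solution, so local uniqueness already places it on the trivial
  -- branch.
  have hx : x = x₀ := hunique x lam hbif.1 (by linarith [abs_nonneg (lam - lam₀)])
    (by linarith [norm_nonneg (x - x₀)])
  subst hx
  -- The parameter ball is centred at `lam₀`, not `lam`, so local uniqueness applies to every
  -- solution in this neighborhood.
  have hnhds : Metric.ball x δ ×ˢ Metric.ball lam₀ δ ∈ 𝓝 (x, lam) :=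
    prod_mem_nhds (Metric.ball_mem_nhds x hδ) (Metric.isOpen_ball.mem_nhds (by
      rw [Metric.mem_ball, Real.dist_eq]
      simpa using hlt))
  obtain ⟨x', lam', ⟨hx', hlam'⟩, hs, hne⟩ := hbif.2 _ hnhds
  exact hne (hunique x' lam' hs (mem_ball_iff_norm.1 hx') (by
    rwa [Metric.mem_ball, Real.dist_eq] at hlam'))
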